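/- Let $K\ge 1$ be an integer, $p\in[0,1)$, $\varepsilon\in[0,1)$, $T_f>0$, $R\ge 0$, and let $t_1,t_2$ be nonnegative random durations with generating functions $\hat t_i(z)=\mathbb E[z^{t_i}]$ that are finite for all $z\ge 0$. Consider the four-state semi-Markov model of a transmitter with states $\mathrm{OFF}_2,\mathrm{OFF}_3,\mathrm{OFF}_1,\mathrm{ON}$. From each of $\mathrm{ON},\mathrm{OFF}_1,\mathrm{OFF}_3$ it moves to $\mathrm{OFF}_2$ with probability $1-p^K$ and to $\mathrm{OFF}_3$ with probability $p^K$; from $\mathrm{OFF}_2$ it moves to $\mathrm{ON}$ with probability $1-\varepsilon$ and to $\mathrm{OFF}_1$ with probability $\varepsilon$. The sojourn times, independent given the visited states, are distributed as $t_1$ in $\mathrm{OFF}_2$, as $t_2$ in $\mathrm{OFF}_3$, and equal $T_f$ in $\mathrm{OFF}_1$ and $\mathrm{ON}$. Data are delivered at rate $R$ in $\mathrm{ON}$ and at rate $0$ otherwise; the initial state is arbitrary. If $S(t)$ is the amount delivered during $(0,t]$, the effective capacity at QoS exponent $\theta>0$ is $-\lim_{t\to\infty}\frac1{\theta t}\log\mathbb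 E[e^{-\theta S(t)}]$. For a semi-Markov model with transition matrix $\mathbf P$ and rates $r_i$, let $\mathbf H(c,u)=\mathbf P\,\mathbf\Gamma(c,u)$, where $\mathbf\Gamma(c,u)$ is diagonal and its $i$-th entry is the moment generating function of the sojourn time in state $i$ at $r_ic-u$, and let $\phi(c,u)$ be the spectral radius of $\mathbf H(c,u)$. Let $t_3$ be the time between the end of a visit to $\mathrm{ON}$ and the beginning of the next visit to $\mathrm{ON}$. Its law does not depend on which visit is considered. For $z\ge 0$, $\hat t_3(z)=\mathbb E[z^{t_3}]$ is finite if and only if $p^K\hat t_2(z)+\varepsilon(1-p^K)\hat t_1(z)z^{T_f}<1$, and then $$\hat t_3(z)=\frac{(1-\varepsilon)(1-p^K)\,\hat t_1(z)}{1-p^K\hat t_2(z)-\varepsilon(1-p^K)\,\hat t_1(z)\,z^{T_f}} .$$ Consider also the two-state semi-Markov model in which an $\mathrm{OFF}$ state of duration distributed as $t_3$ and an $\mathrm{ON}$ state of duration $T_f$ and rate $R$ alternate, with independent sojourn times. Then for every $\theta>0$ and every real $C$ the following are equivalent: 1. $\phi(-\theta,-\theta C)=1$ for the two-state model; 2. $\hat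 t_3(e^{\theta C})<\infty$ and $e^{-\theta(R-C)T_f}\,\hat t_3(e^{\theta C})=1$; 3. $(1-p^K)\,\hat t_1(e^{\theta C})\big[e^{(-R\theta+\theta C)T_f}(1-\varepsilon)+e^{\theta CT_f}\varepsilon\big]+p^K\,\hat t_2(e^{\theta C})=1$; 4. $\phi(-\theta,-\theta C)=1$ for the four-state model. (In statement 1, when $\hat t_3(e^{\theta C})=\infty$ the equation is considered not to hold.) Moreover, exactly one real $C$ satisfies these conditions, and this $C$ is the effective capacity, at exponent $\theta$, of both the four-state model and the two-state model (the defining limits exist). -/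

import Mathlib

open MeasureTheory ProbabilityTheory Filter Topology

/-- Probability generating function `z ↦ 𝔼[z ^ t]` of a real random duration `t` with law `μ`. -/
noncomputable def pgf (μ : Measure ℝ) (z : ℝ) : ℝ := ∫ x, z ^ x ∂μ

/-- A finite-state semi-Markov fluid server: transition probabilities of the embedded jump chain,
the law of the sojourn time in each state, and the service rate in each state. -/
structure SemiMarkovModel (ι : Type) where
  trans : Matrix ι ι ℝ
  dwell : ι → Measure ℝ
  rate : ι → ℝ

namespace SemiMarkovModel

variable {ι : Type} [Fintype ι] [DecidableEq ι]

/-- The matrix `H(c,u) = P Γ(c,u)`, where `Γ(c,u)` is diagonal and its `i`-th entry is the moment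
generating function of the sojourn time in state `i`, evaluated at `rᵢ c - u`. -/
noncomputable def matH (M : SemiMarkovModel ι) (c u : ℝ) : Matrix ι ι ℝ :=
  M.trans * Matrix.diagonal (fun i => mgf id (M.dwell i) (M.rate i * c - u))

/-- The spectral radius `φ(c,u)` of `H(c,u)` (over the complex numbers). -/
noncomputable def phi (M : SemiMarkovModel ι) (c u : ℝ) : ENNReal :=
  spectralRadius ℂ ((M.matH c u).map Complex.ofReal)

end SemiMarkovModel

/-- `(X, T)` is a realization of the semi-Markov model `M`, with an arbitrary initial state:
`X n` is the `n`-th visited state and `T n` the time spent in it.  The jump chain is Markov with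
transition matrix `M.trans`, and given the jump chain the sojourn times are independent, with
`T n` distributed according to `M.dwell (X n)`. -/
structure IsSemiMarkov {ι : Type} (M : SemiMarkovModel ι) {Ω : Type*} [MeasurableSpace Ω]
    (P : Measure Ω) (X : ℕ → Ω → ι) (T : ℕ → Ω → ℝ) : Prop where
  measurable_state : ∀ n i, MeasurableSet {ω | X n ω = i}
  measurable_dwell : ∀ n, Measurable (T n)
  law : ∀ (n : ℕ) (x : ℕ → ι) (A : ℕ → Set ℝ), (∀ i, MeasurableSet (A i)) →
    P {ω | ∀ i ≤ n, X i ω = x i ∧ T i ω ∈ A i} =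
      P {ω | X 0 ω = x 0}
        * (∏ i ∈ Finset.range n, ENNReal.ofReal (M.trans (x i) (x (i + 1))))
        * ∏ i ∈ Finset.range (n + 1), M.dwell (x i) (A i)

/-- The epoch at which the `n`-th sojourn begins. -/
noncomputable def epoch {Ω : Type*} (T : ℕ → Ω → ℝ) (n : ℕ) (ω : Ω) : ℝ :=
  ∑ i ∈ Finset.range n, T i ω

/-- The service `S(t)` delivered during `(0,t]`: the `n`-th sojourn overlaps `(0,t]` for a time
`min t (epoch (n+1)) - min t (epoch n)`, during which the service rate is that of `X n`. -/
noncomputable def service {ι : Type} (M : SemiMarkovModel ι) {Ω : Type*}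
    (X : ℕ → Ω → ι) (T : ℕ → Ω → ℝ) (t : ℝ) (ω : Ω) : ℝ :=
  ∑' n, M.rate (X n ω) * (min t (epoch T (n + 1) ω) - min t (epoch T n ω))

/-- `C` is the effective capacity, at QoS exponent `θ`, of the cumulative service process `S`:
`C = - lim_{t → ∞} (θ t)⁻¹ log 𝔼[exp (-θ S(t))]` (in particular, the limit exists). -/
def IsEffectiveCapacity {Ω : Type*} [MeasurableSpace Ω] (P : Measure Ω) (S : ℝ → Ω → ℝ)
    (θ C : ℝ) : Prop :=
  Tendsto (fun t : ℝ => -(1 / (θ * t) * Real.log (∫ ω, Real.exp (-θ * S t ω) ∂P))) atTop (𝓝 C)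

/-- The four-state model.  States: `0` is OFF₂ (backoffs and collided transmissions of a packet
before its collision-free transmission, duration law `μ₁`), `1` is OFF₃ (backoffs and collided
transmissions of a packet that is dropped after `K` collisions, duration law `μ₂`), `2` is OFF₁
(collision-free but erroneous transmission, duration `Tf`) and `3` is ON (successful
transmission at rate `R`, duration `Tf`). -/
noncomputable def fourState (K : ℕ) (p ε Tf R : ℝ) (μ₁ μ₂ : Measure ℝ) :
    SemiMarkovModel (Fin 4) where
  trans := !![0, 0, ε, 1 - ε;
              1 - p ^ K, p ^ K, 0, 0;
              1 - p ^ K, p ^ K, 0, 0;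
              1 - p ^ K, p ^ K, 0, 0]
  dwell := ![μ₁, μ₂, Measure.dirac Tf, Measure.dirac Tf]
  rate := ![0, 0, 0, R]

/-- The two-state model.  States: `0` is OFF (duration law `μ₃`), `1` is ON (successful
transmission at rate `R`, duration `Tf`); the two states alternate. -/
noncomputable def twoState (Tf R : ℝ) (μ₃ : Measure ℝ) : SemiMarkovModel (Fin 2) where
  trans := !![0, 1; 1, 0]
  dwell := ![μ₃, Measure.dirac Tf]
  rate := ![0, R]

/-- If the `n`-th visited state of the four-state process is ON, this is the time `t₃` between
that successful transmission and the next one: the total duration of the sojourns after the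
`n`-th one that precede the next visit to ON. -/
noncomputable def offDuration {Ω : Type*} (X : ℕ → Ω → Fin 4) (T : ℕ → Ω → ℝ)
    (n : ℕ) (ω : Ω) : ℝ :=
  ∑' j, {ω' | ∀ i ≤ j, X (n + 1 + i) ω' ≠ 3}.indicator (T (n + 1 + j)) ω

/-- The characteristic equation of the four-state model for the effective capacity `C`. -/
def FourStateEquation (K : ℕ) (p ε Tf R : ℝ) (μ₁ μ₂ : Measure ℝ) (θ C : ℝ) : Prop :=
  (1 - p ^ K) * pgf μ₁ (Real.exp (θ * C)) *
      (Real.exp ((-R * θ + θ * C) * Tf) * (1 - ε) + Real.exp (θ * C * Tf) * ε)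
    + p ^ K * pgf μ₂ (Real.exp (θ * C)) = 1

/-- The characteristic equation of the two-state model for the effective capacity `C`; the
generating function of the OFF duration is required to converge. -/
def TwoStateEquation (Tf R : ℝ) (μ₃ : Measure ℝ) (θ C : ℝ) : Prop :=
  Integrable (fun x : ℝ => Real.exp (θ * C) ^ x) μ₃ ∧
    Real.exp (-θ * (R - C) * Tf) * pgf μ₃ (Real.exp (θ * C)) = 1

/-! The capacity is found by exponential tilting and optional stopping. Weight a sojourn of length y
in state i by exp(θCy - θ rᵢ y). If a positive vector v is fixed by the one-step operator `stepGain`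
(the matrix ΓP, which has the nonzero spectrum of H = PΓ), then weight times v(Xₙ) is a martingale.
Stop it at the end of the sojourn containing τ. There the weight is exp(-θS(τ) + θCτ), up to the
part of that sojourn beyond τ.

Only inequalities are used. With `stepGain v ≤ v`, C ≥ 0 and bounded service per sojourn, 𝔼
exp(-θS(τ)) is O(exp(-θCτ)). The reverse bound needs a bounded overshoot, so sojourns longer than t₀
get weight zero. For each C' > C the untruncated gain exceeds one, hence so does the gain truncated
at a large t₀, and exp(-θC'τ) is a lower bound up to a constant. Letting C' decrease to C gives the
limit (`IsSemiMarkov.isEffectiveCapacity`). A contraction for the discount exp(-y) shows that the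
epochs tend to infinity.

The nonzero eigenvalues of both matrices H are the nonzero roots of k² = bk + c with b, c ≥ 0. The
nonnegative dominant root equals the spectral radius, and it is 1 exactly when b + c = 1. This turns
φ = 1 into the characteristic equations.

The law of t₃ is a sum over the number of intermediate sojourns. Its transform obeys a two-term
recursion that sums to a geometric series (`lintegral_rpow_returnLaw_fourState`). Working in
`ENNReal` gives the formula and its exact domain together; at z = 1 it gives mass one, so the return
to ON is certain. Clearing the denominator identifies the two equations. The four-state one is
strictly increasing and continuous in C and crosses 1 between 0 and R, hence the unique root. -/

/-- The event that the chain follows the path `x` up to time `n` and that the sojourn times before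
time `n` lie in the sets `A`. -/
def pathBox {ι Ω : Type*} (X : ℕ → Ω → ι) (T : ℕ → Ω → ℝ) (n : ℕ) (x : ℕ → ι)
    (A : ℕ → Set ℝ) : Set Ω :=
  {ω | (∀ i ≤ n, X i ω = x i) ∧ ∀ i < n, T i ω ∈ A i}

/-- The path events up to time `n` with Borel constraints on the earlier sojourn times. -/
def pathBoxes {ι Ω : Type*} (X : ℕ → Ω → ι) (T : ℕ → Ω → ℝ) (n : ℕ) : Set (Set Ω) :=
  {s | ∃ x A, (∀ i, MeasurableSet (A i)) ∧ s = pathBox X T n x A}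

/-- The σ-algebra generated by the states up to time `n` and the sojourn times before time `n`. -/
@[reducible] def pastSigma {ι Ω : Type*} (X : ℕ → Ω → ι) (T : ℕ → Ω → ℝ) (n : ℕ) : MeasurableSpace Ω :=
  MeasurableSpace.generateFrom (pathBoxes X T n)

/-! ### The σ-algebra of the past -/

section Past

variable {ι Ω : Type*} {X : ℕ → Ω → ι} {T : ℕ → Ω → ℝ}

/-- Two boxes with a common point prescribe the same path up to time n, so only their sojourn
constraints have to be intersected. -/
theorem isPiSystem_pathBoxes (n : ℕ) : IsPiSystem (pathBoxes X T n) := by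
  rintro _ ⟨x, A, hA, rfl⟩ _ ⟨y, B, hB, rfl⟩ ⟨ω₀, h₁, h₂⟩
  refine ⟨x, fun i => A i ∩ B i, fun i => (hA i).inter (hB i), ?_⟩
  ext ω
  simp only [pathBox, Set.mem_inter_iff, Set.mem_ofPred_eq]
  constructor
  · rintro ⟨⟨h, hA⟩, _, hB⟩
    exact ⟨h, fun i hi => ⟨hA i hi, hB i hi⟩⟩
  · rintro ⟨h, hAB⟩
    exact ⟨⟨h, fun i hi => (hAB i hi).1⟩,
      fun i hi => by rw [h i hi, ← h₁.1 i hi, h₂.1 i hi], fun i hi => (hAB i hi).2⟩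

/-- A finite path, extended to all times. -/
def extendPath {n : ℕ} (y : Fin (n + 1) → ι) (k : ℕ) : ι := y (Fin.ofNat (n + 1) k)

theorem extendPath_eq {n : ℕ} (f : ℕ → ι) {k : ℕ} (hk : k ≤ n) :
    extendPath (fun i : Fin (n + 1) => f i) k = f k := by
  simp [extendPath, Nat.mod_eq_of_lt (Nat.lt_succ_of_le hk)]

theorem pathBox_mem {n : ℕ} (x : ℕ → ι) (A : ℕ → Set ℝ) (hA : ∀ i, MeasurableSet (A i)) :
    MeasurableSet[pastSigma X T n] (pathBox X T n x A) :=
  MeasurableSpace.measurableSet_generateFrom ⟨x, A, hA, rfl⟩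

theorem measurableSet_past_state [Finite ι] {n i : ℕ} (hi : i ≤ n) (j : ι) :
    MeasurableSet[pastSigma X T n] {ω | X i ω = j} := by
  have : {ω | X i ω = j} = ⋃ y : Fin (n + 1) → ι, ⋃ _ : extendPath y i = j,
      pathBox X T n (extendPath y) fun _ => Set.univ := by
    ext ω
    simp only [Set.mem_ofPred_eq, Set.mem_iUnion, pathBox, Set.mem_univ, implies_true, and_true]
    constructor
    · intro h
      exact ⟨fun k => X k ω, by rw [extendPath_eq (fun k => X k ω) hi, h],
        fun k hk => (extendPath_eq (fun k => X k ω) hk).symm⟩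
    · rintro ⟨y, rfl, h⟩
      exact h i hi
  rw [this]
  exact MeasurableSet.iUnion fun y => MeasurableSet.iUnion fun _ =>
    pathBox_mem _ _ fun _ => MeasurableSet.univ

theorem measurable_past_dwell [Finite ι] {n i : ℕ} (hi : i < n) :
    Measurable[pastSigma X T n] (T i) := by
  intro B hB
  have : T i ⁻¹' B = ⋃ y : Fin (n + 1) → ι,
      pathBox X T n (extendPath y) (fun k => if k = i then B else Set.univ) := by
    ext ω
    simp only [Set.mem_preimage, Set.mem_iUnion, pathBox, Set.mem_ofPred_eq]
    constructor
    · intro h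
      refine ⟨fun k => X k ω, fun k hk => (extendPath_eq (fun k => X k ω) hk).symm, ?_⟩
      intro k _
      split_ifs with hk
      · exact hk ▸ h
      · trivial
    · rintro ⟨y, _, h⟩
      simpa using h i hi
  rw [this]
  refine MeasurableSet.iUnion fun y => pathBox_mem _ _ fun k => ?_
  split_ifs
  · exact hB
  · exact MeasurableSet.univ

theorem pathBox_measurableSet {m : MeasurableSpace Ω} {n : ℕ}
    (hX : ∀ i ≤ n, ∀ j, MeasurableSet[m] {ω | X i ω = j}) (hT : ∀ i < n, Measurable[m] (T i))
    (x : ℕ → ι) (A : ℕ → Set ℝ) (hA : ∀ i, MeasurableSet (A i)) :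
    MeasurableSet[m] (pathBox X T n x A) := by
  have : pathBox X T n x A =
      (⋂ i, ⋂ _ : i ≤ n, {ω | X i ω = x i}) ∩ ⋂ i, ⋂ _ : i < n, T i ⁻¹' (A i) := by
    ext ω
    simp [pathBox]
  rw [this]
  exact (MeasurableSet.iInter fun i => MeasurableSet.iInter fun hi => hX i hi _).inter
    (MeasurableSet.iInter fun i => MeasurableSet.iInter fun hi => hT i hi (hA i))

theorem pastSigma_le {m : MeasurableSpace Ω} {n : ℕ}
    (hX : ∀ i ≤ n, ∀ j, MeasurableSet[m] {ω | X i ω = j}) (hT : ∀ i < n, Measurable[m] (T i)) :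
    pastSigma X T n ≤ m := by
  refine MeasurableSpace.generateFrom_le ?_
  rintro _ ⟨x, A, hA, rfl⟩
  exact pathBox_measurableSet hX hT x A hA

theorem measurable_of_state [Finite ι] {β : Type*} [MeasurableSpace β] {m : MeasurableSpace Ω}
    {Y : Ω → ι} (hY : ∀ j, MeasurableSet[m] {ω | Y ω = j}) {F : ι → Ω → β}
    (hF : ∀ i, Measurable[m] (F i)) : Measurable[m] fun ω => F (Y ω) ω := by
  intro s hs
  have : (fun ω => F (Y ω) ω) ⁻¹' s = ⋃ i, {ω | Y ω = i} ∩ F i ⁻¹' s := by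
    ext ω
    simp
  rw [this]
  exact MeasurableSet.iUnion fun i => (hY i).inter (hF i hs)

theorem measurable_past_epoch [Finite ι] (n : ℕ) : Measurable[pastSigma X T n] (epoch T n) := by
  unfold epoch
  exact Finset.measurable_fun_sum _ fun i hi => measurable_past_dwell (Finset.mem_range.1 hi)

end Past

/-! ### The Markov property at a jump -/

section Step

variable {ι : Type} [Fintype ι] {Ω : Type*} [MeasurableSpace Ω] {M : SemiMarkovModel ι}
  {P : Measure Ω} {X : ℕ → Ω → ι} {T : ℕ → Ω → ℝ}

omit [Fintype ι] in
theorem IsSemiMarkov.pastSigma_le (h : IsSemiMarkov M P X T) (n : ℕ) :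
    pastSigma X T n ≤ ‹MeasurableSpace Ω› :=
  _root_.pastSigma_le (fun i _ j => h.measurable_state i j) fun i _ => h.measurable_dwell i

/-- Almost sure properties of the sojourn laws hold along the process. -/
theorem IsSemiMarkov.ae_dwell (h : IsSemiMarkov M P X T)
    {p : ι → ℝ → Prop} (hp : ∀ i, ∀ᵐ y ∂M.dwell i, p i y) (n : ℕ) :
    ∀ᵐ ω ∂P, p (X n ω) (T n ω) := by
  -- `p` need not be measurable, so the bad set is replaced by its measurable hull. The constraint
  -- is active only at k = n, where it makes one factor of the law vanish; there are finitely many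
  -- paths.
  have key : ∀ y : Fin (n + 1) → ι,
      P {ω | ∀ k ≤ n, X k ω = extendPath y k ∧
        T k ω ∈ toMeasurable (M.dwell (extendPath y k)) {z | k = n → ¬ p (extendPath y k) z}}
        = 0 := by
    intro y
    rw [h.law n (extendPath y)
      (fun k => toMeasurable (M.dwell (extendPath y k)) {z | k = n → ¬ p (extendPath y k) z})
      fun k => measurableSet_toMeasurable _ _, Finset.prod_range_succ]
    have : M.dwell (extendPath y n) {z | n = n → ¬ p (extendPath y n) z} = 0 := by
      simpa [ae_iff] using hp (extendPath y n)
    rw [measure_toMeasurable, this]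
    simp
  rw [ae_iff]
  refine measure_mono_null ?_ (measure_iUnion_null key)
  intro ω hω
  rw [Set.mem_iUnion]
  refine ⟨fun k => X k ω, fun k hk => ?_⟩
  rw [extendPath_eq (fun k => X k ω) hk]
  refine ⟨rfl, subset_toMeasurable _ _ ?_⟩
  rintro rfl
  exact hω

theorem lintegral_eq_sum_state (Q : Measure Ω) {Y : Ω → ι}
    (hY : ∀ j, MeasurableSet {ω | Y ω = j}) (f : Ω → ENNReal) :
    ∫⁻ ω, f ω ∂Q = ∑ j, ∫⁻ ω in {ω | Y ω = j}, f ω ∂Q := by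
  have hU : (⋃ j ∈ Finset.univ, {ω | Y ω = j}) = Set.univ := by
    ext ω
    simp
  rw [← lintegral_biUnion_finset _ fun j _ => hY j, hU, Measure.restrict_univ]
  intro a _ b _ hab
  refine Set.disjoint_left.2 fun ω h1 h2 => hab ?_
  exact h1.symm.trans h2

variable [IsProbabilityMeasure P] [∀ i, IsProbabilityMeasure (M.dwell i)]

omit [Fintype ι] [IsProbabilityMeasure P] in
-- Both events have the form covered by `law` once the last sojourn is left free, which costs a
-- factor 1. The quotient is one transition and one sojourn factor.
theorem IsSemiMarkov.measure_step_pathBox (h : IsSemiMarkov M P X T) (n : ℕ) (x : ℕ → ι)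
    (A : ℕ → Set ℝ) (hA : ∀ i, MeasurableSet (A i)) (j : ι) (B : Set ℝ) (hB : MeasurableSet B) :
    P (pathBox X T n x A ∩ (T n ⁻¹' B ∩ {ω | X (n + 1) ω = j})) =
      P (pathBox X T n x A) * (ENNReal.ofReal (M.trans (x n) j) * M.dwell (x n) B) := by
  have e₁ : pathBox X T n x A = {ω | ∀ i ≤ n, X i ω = x i ∧
      T i ω ∈ (if i < n then A i else Set.univ)} := by
    ext ω
    simp only [pathBox, Set.mem_ofPred_eq]
    constructor
    · rintro ⟨h₁, h₂⟩ i hi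
      refine ⟨h₁ i hi, ?_⟩
      split_ifs with hin
      · exact h₂ i hin
      · trivial
    · intro h
      refine ⟨fun i hi => (h i hi).1, fun i hi => ?_⟩
      simpa [hi] using (h i hi.le).2
  have e₂ : pathBox X T n x A ∩ (T n ⁻¹' B ∩ {ω | X (n + 1) ω = j}) =
      {ω | ∀ i ≤ n + 1, X i ω = (if i = n + 1 then j else x i) ∧
        T i ω ∈ (if i < n then A i else if i = n then B else Set.univ)} := by
    ext ω
    simp only [pathBox, Set.mem_inter_iff, Set.mem_ofPred_eq, Set.mem_preimage]
    constructor
    · rintro ⟨⟨h₁, h₂⟩, h₃, h₄⟩ i hi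
      rcases Nat.lt_or_ge i n with hin | hin
      · have h1 : i ≠ n + 1 := by lia
        simpa [hin, h1] using ⟨h₁ i hin.le, h₂ i hin⟩
      · rcases hin.eq_or_lt with rfl | hin
        · simpa using ⟨h₁ n le_rfl, h₃⟩
        · have h1 : i = n + 1 := by lia
          subst h1
          simpa using h₄
    · intro h
      refine ⟨⟨fun i hi => ?_, fun i hi => ?_⟩, ?_, ?_⟩
      · have h1 : i ≠ n + 1 := by lia
        simpa [h1] using (h i (by lia)).1
      · simpa [hi] using (h i (by lia)).2
      · simpa using (h n (by lia)).2
      · simpa using (h (n + 1) le_rfl).1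
  rw [e₂, e₁, h.law (n + 1) (fun i => if i = n + 1 then j else x i)
      (fun i => if i < n then A i else if i = n then B else Set.univ) ?_,
    h.law n x (fun i => if i < n then A i else Set.univ) ?_]
  · simp only [Finset.prod_range_succ]
    have p₁ : ∏ i ∈ Finset.range n, ENNReal.ofReal (M.trans (if i = n + 1 then j else x i)
          (if i + 1 = n + 1 then j else x (i + 1))) =
        ∏ i ∈ Finset.range n, ENNReal.ofReal (M.trans (x i) (x (i + 1))) := by
      refine Finset.prod_congr rfl fun i hi => ?_
      have := Finset.mem_range.1 hi
      rw [if_neg (by lia), if_neg (by lia)]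
    have p₂ : ∏ i ∈ Finset.range n, M.dwell (if i = n + 1 then j else x i)
          (if i < n then A i else if i = n then B else Set.univ) =
        ∏ i ∈ Finset.range n, M.dwell (x i) (if i < n then A i else Set.univ) := by
      refine Finset.prod_congr rfl fun i hi => ?_
      have := Finset.mem_range.1 hi
      rw [if_neg (by lia), if_pos this, if_pos this]
    rw [p₁, p₂]
    simp only [lt_self_iff_false, if_false, if_true, measure_univ, mul_one, Nat.left_eq_add,
      one_ne_zero, Nat.add_eq_left, (Nat.lt_succ_self n).not_gt,
      (Nat.succ_ne_zero n).symm]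
    ring
  · intro i
    split_ifs
    · exact hA i
    · exact MeasurableSet.univ
  · intro i
    split_ifs
    · exact hA i
    · exact hB
    · exact MeasurableSet.univ

/-- The Markov property at a jump: given the past and the present state, the sojourn time and the
next state are independent. -/
theorem IsSemiMarkov.measure_step (h : IsSemiMarkov M P X T) (n : ℕ) (i j : ι) (A : Set Ω)
    (hA : MeasurableSet[pastSigma X T n] A) (B : Set ℝ) (hB : MeasurableSet B) :
    P (A ∩ ({ω | X n ω = i} ∩ (T n ⁻¹' B ∩ {ω | X (n + 1) ω = j}))) =
      P (A ∩ {ω | X n ω = i}) * (ENNReal.ofReal (M.trans i j) * M.dwell i B) := by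
  have hle := h.pastSigma_le n
  set c := ENNReal.ofReal (M.trans i j) * M.dwell i B with hc
  set D := {ω | X n ω = i} ∩ (T n ⁻¹' B ∩ {ω | X (n + 1) ω = j}) with hD
  have hmeas : MeasurableSet D := (h.measurable_state n i).inter
    ((h.measurable_dwell n hB).inter (h.measurable_state (n + 1) j))
  -- As functions of A both sides are finite measures on the past that agree on the π-system of
  -- boxes. The finitely many boxes without sojourn constraints cover Ω.
  have key : (P.restrict D).trim hle = (c • P.restrict {ω | X n ω = i}).trim hle := by
    refine @Measure.ext_of_generateFrom_of_cover_subset Ω (pastSigma X T n) _ _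
      (pathBoxes X T n)
      (Set.range fun y : Fin (n + 1) → ι => pathBox X T n (extendPath y) fun _ => Set.univ)
      rfl (isPiSystem_pathBoxes n) ?_ (Set.countable_range _) ?_ ?_ ?_
    · rintro _ ⟨y, rfl⟩
      exact ⟨_, _, fun _ => MeasurableSet.univ, rfl⟩
    · refine Set.eq_univ_of_forall fun ω => ?_
      refine Set.mem_sUnion.2 ⟨_, ⟨fun k => X k ω, rfl⟩, ?_⟩
      exact ⟨fun k hk => (extendPath_eq (fun k => X k ω) hk).symm, fun _ _ => trivial⟩
    · rintro _ ⟨y, rfl⟩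
      rw [trim_measurableSet_eq hle (pathBox_mem _ _ fun _ => MeasurableSet.univ)]
      exact measure_ne_top _ _
    · rintro _ ⟨x, A', hA', rfl⟩
      have hm := pathBox_mem (X := X) (T := T) (n := n) x A' hA'
      rw [trim_measurableSet_eq hle hm, trim_measurableSet_eq hle hm, Measure.smul_apply,
        Measure.restrict_apply (hle _ hm), Measure.restrict_apply (hle _ hm), smul_eq_mul]
      by_cases hx : x n = i
      · have e : pathBox X T n x A' ∩ {ω | X n ω = i} = pathBox X T n x A' := by
          refine Set.inter_eq_left.2 fun ω hω => ?_
          exact (hω.1 n le_rfl).trans hx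
        rw [hD, ← Set.inter_assoc, e, h.measure_step_pathBox n x A' hA' j B hB, hx, mul_comm]
      · have e : pathBox X T n x A' ∩ {ω | X n ω = i} = ∅ := by
          refine Set.eq_empty_of_forall_notMem fun ω hω => hx ?_
          exact (hω.1.1 n le_rfl).symm.trans hω.2
        rw [hD, ← Set.inter_assoc, e]
        simp
  have k2 : (P.restrict D).trim hle A = (c • P.restrict {ω | X n ω = i}).trim hle A := by
    rw [key]
  rw [trim_measurableSet_eq hle hA, trim_measurableSet_eq hle hA, Measure.smul_apply,
    Measure.restrict_apply (hle _ hA), Measure.restrict_apply (hle _ hA), smul_eq_mul] at k2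
  rw [k2, mul_comm]

/-- Rectangles determine a product measure, so `measure_step` upgrades to a joint law. This form
gives access to Fubini and to convolutions. -/
theorem IsSemiMarkov.map_step (h : IsSemiMarkov M P X T) (n : ℕ) (i j : ι) {A : Set Ω}
    (hA : MeasurableSet[pastSigma X T n] A) {α : Type*} [MeasurableSpace α] {U : Ω → α}
    (hU : Measurable[pastSigma X T n] U) :
    (P.restrict (A ∩ ({ω | X n ω = i} ∩ {ω | X (n + 1) ω = j}))).map (fun ω => (U ω, T n ω)) =
      ((P.restrict (A ∩ {ω | X n ω = i})).map U).prod
        (ENNReal.ofReal (M.trans i j) • M.dwell i) := by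
  have hle := h.pastSigma_le n
  have hU' : Measurable U := hU.mono hle le_rfl
  have : IsFiniteMeasure (ENNReal.ofReal (M.trans i j) • M.dwell i) :=
    Measure.smul_finite _ ENNReal.ofReal_ne_top
  refine (Measure.prod_eq fun s t hs ht => ?_).symm
  rw [Measure.map_apply (hU'.prodMk (h.measurable_dwell n)) (hs.prod ht),
    Measure.map_apply hU' hs, Measure.restrict_apply (hU' hs),
    Measure.restrict_apply ((hU'.prodMk (h.measurable_dwell n)) (hs.prod ht)),
    Measure.smul_apply, smul_eq_mul, ← Set.inter_assoc (U ⁻¹' s)]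
  refine Eq.trans ?_ (h.measure_step n i j _ (MeasurableSet.inter (hU hs) hA) t ht)
  congr 1
  ext ω
  simp only [Set.mem_inter_iff, Set.mem_preimage, Set.mem_prod, Set.mem_ofPred_eq]
  tauto

/-- The one-step expectation formula. -/
theorem IsSemiMarkov.lintegral_step (h : IsSemiMarkov M P X T) (n : ℕ) {U : Ω → ENNReal}
    (hU : Measurable[pastSigma X T n] U) {ψ : ι → ℝ → ENNReal} (hψ : ∀ i, Measurable (ψ i))
    (v : ι → ENNReal) :
    ∫⁻ ω, U ω * ψ (X n ω) (T n ω) * v (X (n + 1) ω) ∂P =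
      ∫⁻ ω, U ω * ((∫⁻ y, ψ (X n ω) y ∂M.dwell (X n ω)) *
        ∑ j, ENNReal.ofReal (M.trans (X n ω) j) * v j) ∂P := by
  have hle := h.pastSigma_le n
  have hU' : Measurable U := hU.mono hle le_rfl
  rw [lintegral_eq_sum_state P (h.measurable_state n),
    lintegral_eq_sum_state P (h.measurable_state n)]
  refine Finset.sum_congr rfl fun i _ => ?_
  rw [lintegral_eq_sum_state _ (h.measurable_state (n + 1))]
  have step : ∀ j, ∫⁻ ω in {ω | X (n + 1) ω = j}, U ω * ψ (X n ω) (T n ω) * v (X (n + 1) ω)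
      ∂P.restrict {ω | X n ω = i} =
      (∫⁻ ω in {ω | X n ω = i}, U ω ∂P) *
        ((∫⁻ y, ψ i y ∂M.dwell i) * (ENNReal.ofReal (M.trans i j) * v j)) := by
    intro j
    rw [Measure.restrict_restrict (h.measurable_state (n + 1) j), Set.inter_comm]
    have e : ∫⁻ ω in {ω | X n ω = i} ∩ {ω | X (n + 1) ω = j},
        U ω * ψ (X n ω) (T n ω) * v (X (n + 1) ω) ∂P =
        ∫⁻ ω in {ω | X n ω = i} ∩ {ω | X (n + 1) ω = j}, U ω * ψ i (T n ω) * v j ∂P := by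
      refine setLIntegral_congr_fun
        ((h.measurable_state n i).inter (h.measurable_state (n + 1) j)) ?_
      intro ω hω
      have h1 : X n ω = i := hω.1
      have h2 : X (n + 1) ω = j := hω.2
      simp only [h1, h2]
    have m := h.map_step n i j (A := Set.univ) (@MeasurableSet.univ _ (pastSigma X T n)) hU
    rw [Set.univ_inter, Set.univ_inter] at m
    have hm : Measurable fun ω => (U ω, T n ω) := hU'.prodMk (h.measurable_dwell n)
    have hf : Measurable fun q : ENNReal × ℝ => q.1 * ψ i q.2 :=
      measurable_fst.mul ((hψ i).comp measurable_snd)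
    have : IsFiniteMeasure (ENNReal.ofReal (M.trans i j) • M.dwell i) :=
      Measure.smul_finite _ ENNReal.ofReal_ne_top
    rw [e, lintegral_mul_const _ (show Measurable fun ω => U ω * ψ i (T n ω) from hf.comp hm),
      ← lintegral_map (f := fun q : ENNReal × ℝ => q.1 * ψ i q.2) hf hm, m,
      lintegral_prod_mul (f := fun x : ENNReal => x) measurable_id.aemeasurable
        (hψ i).aemeasurable,
      lintegral_map (f := fun x : ENNReal => x) measurable_id hU', lintegral_smul_measure, smul_eq_mul]
    ring
  rw [Finset.sum_congr rfl fun j _ => step j, ← Finset.mul_sum, ← Finset.mul_sum,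
    ← lintegral_mul_const _ hU']
  refine setLIntegral_congr_fun (h.measurable_state n i) ?_
  intro ω hω
  have h1 : X n ω = i := hω
  simp only [h1]

end Step

/-! ### Path weights, epochs and accumulated service -/

/-- The product of the weights `ψ` of the first `n` sojourns. -/
noncomputable def pathWeight {ι Ω : Type*} (ψ : ι → ℝ → ENNReal) (X : ℕ → Ω → ι)
    (T : ℕ → Ω → ℝ) (n : ℕ) (ω : Ω) : ENNReal :=
  ∏ k ∈ Finset.range n, ψ (X k ω) (T k ω)

/-- The expected gain of a potential `v` over one jump, when sojourns are weighted by `ψ`. -/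
noncomputable def stepGain {ι : Type} [Fintype ι] (M : SemiMarkovModel ι)
    (ψ : ι → ℝ → ENNReal) (v : ι → ENNReal) (i : ι) : ENNReal :=
  (∫⁻ y, ψ i y ∂M.dwell i) * ∑ j, ENNReal.ofReal (M.trans i j) * v j

/-- The service delivered by the first `n` sojourns. -/
noncomputable def cumService {ι : Type} {Ω : Type*} (M : SemiMarkovModel ι) (X : ℕ → Ω → ι)
    (T : ℕ → Ω → ℝ) (n : ℕ) (ω : Ω) : ℝ :=
  ∑ k ∈ Finset.range n, M.rate (X k ω) * T k ω

/-- The event that time `τ` falls into the `n`-th sojourn. -/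
def exitSet {Ω : Type*} (T : ℕ → Ω → ℝ) (τ : ℝ) (n : ℕ) : Set Ω :=
  {ω | epoch T n ω ≤ τ ∧ τ < epoch T (n + 1) ω}

section Paths

variable {ι : Type} {Ω : Type*} {M : SemiMarkovModel ι} {X : ℕ → Ω → ι} {T : ℕ → Ω → ℝ} {ω : Ω}

theorem epoch_succ (T : ℕ → Ω → ℝ) (n : ℕ) (ω : Ω) :
    epoch T (n + 1) ω = epoch T n ω + T n ω := by
  simp [epoch, Finset.sum_range_succ]

theorem epoch_mono (hT : ∀ n, 0 ≤ T n ω) : Monotone fun n => epoch T n ω :=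
  monotone_nat_of_le_succ fun n => by
    rw [epoch_succ]
    linarith [hT n]

theorem exists_mem_exitSet {τ : ℝ} (hτ : 0 ≤ τ) (h : ∃ n, τ < epoch T n ω) :
    ∃ n, ω ∈ exitSet T τ n := by
  classical
  have h0 : Nat.find h ≠ 0 := by
    intro h0
    have := Nat.find_spec h
    rw [h0] at this
    simp [epoch] at this
    linarith
  obtain ⟨m, hm⟩ := Nat.exists_eq_succ_of_ne_zero h0
  refine ⟨m, not_lt.1 (Nat.find_min h (by lia)), ?_⟩
  have := Nat.find_spec h
  rwa [hm] at this

theorem hasSum_service {τ : ℝ} (hT : ∀ n, 0 ≤ T n ω) {n : ℕ} (hn : ω ∈ exitSet T τ n) :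
    HasSum (fun k => M.rate (X k ω) * (min τ (epoch T (k + 1) ω) - min τ (epoch T k ω)))
      (cumService M X T n ω + M.rate (X n ω) * (τ - epoch T n ω)) := by
  have hz : ∀ k ∉ Finset.range (n + 1),
      M.rate (X k ω) * (min τ (epoch T (k + 1) ω) - min τ (epoch T k ω)) = 0 := by
    intro k hk
    have hk' : n + 1 ≤ k := by simpa using hk
    have h1 : epoch T (n + 1) ω ≤ epoch T k ω := epoch_mono hT hk'
    have h2 : epoch T k ω ≤ epoch T (k + 1) ω := epoch_mono hT k.le_succ
    rw [min_eq_left (by linarith [hn.2]), min_eq_left (by linarith [hn.2]), sub_self, mul_zero]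
  have hs := hasSum_sum_of_ne_finset_zero (L := SummationFilter.unconditional ℕ) hz
  convert hs using 1
  rw [Finset.sum_range_succ, min_eq_left hn.2.le, min_eq_right hn.1]
  congr 1
  refine Finset.sum_congr rfl fun k hk => ?_
  have hk' : k + 1 ≤ n := Finset.mem_range.1 hk
  have h1 : epoch T (k + 1) ω ≤ epoch T n ω := epoch_mono hT hk'
  have h2 : epoch T k ω ≤ epoch T (k + 1) ω := epoch_mono hT k.le_succ
  rw [min_eq_right (h1.trans hn.1), min_eq_right ((h2.trans h1).trans hn.1), epoch_succ]
  ring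

theorem service_eq {τ : ℝ} (hT : ∀ n, 0 ≤ T n ω) {n : ℕ} (hn : ω ∈ exitSet T τ n) :
    service M X T τ ω = cumService M X T n ω + M.rate (X n ω) * (τ - epoch T n ω) :=
  (hasSum_service hT hn).tsum_eq

theorem cumService_nonneg (hr : ∀ i, 0 ≤ M.rate i) (hT : ∀ n, 0 ≤ T n ω) (n : ℕ) :
    0 ≤ cumService M X T n ω :=
  Finset.sum_nonneg fun k _ => mul_nonneg (hr _) (hT k)

theorem service_le (hr : ∀ i, 0 ≤ M.rate i) (hT : ∀ n, 0 ≤ T n ω) {τ : ℝ} {n : ℕ}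
    (hn : ω ∈ exitSet T τ n) : service M X T τ ω ≤ cumService M X T (n + 1) ω := by
  rw [service_eq hT hn, cumService, cumService, Finset.sum_range_succ]
  have := hn.2
  rw [epoch_succ] at this
  gcongr
  · exact hr _
  · linarith

theorem cumService_le (hr : ∀ i, 0 ≤ M.rate i) (hT : ∀ n, 0 ≤ T n ω) {τ B : ℝ} {n : ℕ}
    (hB : M.rate (X n ω) * T n ω ≤ B) (hn : ω ∈ exitSet T τ n) :
    cumService M X T (n + 1) ω ≤ service M X T τ ω + B := by
  rw [service_eq hT hn, cumService, cumService, Finset.sum_range_succ]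
  have := mul_nonneg (hr (X n ω)) (sub_nonneg.2 hn.1)
  linarith

theorem pathWeight_exp (M : SemiMarkovModel ι) (a θ : ℝ) (X : ℕ → Ω → ι) (T : ℕ → Ω → ℝ) (n : ℕ)
    (ω : Ω) :
    pathWeight (fun i y => ENNReal.ofReal (Real.exp (a * y - θ * (M.rate i * y)))) X T n ω =
      ENNReal.ofReal (Real.exp (a * epoch T n ω - θ * cumService M X T n ω)) := by
  rw [pathWeight, ← ENNReal.ofReal_prod_of_nonneg fun _ _ => (Real.exp_pos _).le, ← Real.exp_sum,
    Finset.sum_sub_distrib, ← Finset.mul_sum, ← Finset.mul_sum, epoch, cumService]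

theorem notMem_exitSet_of_lt {m n : ℕ} (hmn : m < n) (hT : ∀ n, 0 ≤ T n ω) {τ : ℝ}
    (hm : ω ∈ exitSet T τ m) : ω ∉ exitSet T τ n := fun hn => by
  have h1 : epoch T (m + 1) ω ≤ epoch T n ω := epoch_mono hT hmn
  linarith [hm.2, hn.1]

end Paths

theorem exists_pos_bounds {ι : Type*} [Finite ι] {v : ι → ℝ} (hv : ∀ i, 0 < v i) :
    ∃ a b : ℝ, 0 < a ∧ 0 < b ∧ ∀ i, a ≤ v i ∧ v i ≤ b := by
  rcases isEmpty_or_nonempty ι with h | h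
  · exact ⟨1, 1, one_pos, one_pos, fun i => h.elim i⟩
  · obtain ⟨i, hi⟩ := Finite.exists_min v
    obtain ⟨j, hj⟩ := Finite.exists_max v
    exact ⟨v i, v j, hv i, hv j, fun k => ⟨hi k, hj k⟩⟩

/-! ### Optional stopping at the exit from [0, τ] -/

section Stopping

variable {ι : Type} [Fintype ι] {Ω : Type*} [MeasurableSpace Ω] {M : SemiMarkovModel ι}
  {P : Measure Ω} {X : ℕ → Ω → ι} {T : ℕ → Ω → ℝ}

omit [MeasurableSpace Ω] in
theorem measurable_pathWeight {ψ : ι → ℝ → ENNReal} (hψ : ∀ i, Measurable (ψ i)) (n : ℕ) :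
    Measurable[pastSigma X T n] (pathWeight ψ X T n) := by
  unfold pathWeight
  refine Finset.measurable_fun_prod _ fun k hk => ?_
  have hk' := Finset.mem_range.1 hk
  exact @measurable_of_state ι Ω _ _ _ (pastSigma X T n) (X k)
    (fun j => measurableSet_past_state hk'.le j) (fun i ω => ψ i (T k ω))
    fun i => (hψ i).comp (measurable_past_dwell hk')

theorem IsSemiMarkov.measurable_epoch (h : IsSemiMarkov M P X T) (n : ℕ) :
    Measurable (epoch T n) :=
  (measurable_past_epoch (X := X) n).mono (h.pastSigma_le n) le_rfl

theorem IsSemiMarkov.measurableSet_exitSet (h : IsSemiMarkov M P X T) (τ : ℝ) (n : ℕ) :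
    MeasurableSet (exitSet T τ n) :=
  (measurableSet_le (h.measurable_epoch n) measurable_const).inter
    (measurableSet_lt measurable_const (h.measurable_epoch (n + 1)))

theorem IsSemiMarkov.ae_dwell_nonneg (h : IsSemiMarkov M P X T)
    (hd : ∀ i, ∀ᵐ y ∂M.dwell i, 0 ≤ y) : ∀ᵐ ω ∂P, ∀ n, 0 ≤ T n ω :=
  ae_all_iff.2 fun n => h.ae_dwell (p := fun _ y => 0 ≤ y) hd n

variable [IsProbabilityMeasure P] [∀ i, IsProbabilityMeasure (M.dwell i)]

/-- The martingale relation for weight times potential, tested on a past event; `stepGain M ψ v` is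
the compensator. -/
theorem IsSemiMarkov.setLIntegral_step (h : IsSemiMarkov M P X T) {ψ : ι → ℝ → ENNReal}
    (hψ : ∀ i, Measurable (ψ i)) (v : ι → ENNReal) (n : ℕ) {A : Set Ω}
    (hA : MeasurableSet[pastSigma X T n] A) :
    ∫⁻ ω in A, pathWeight ψ X T (n + 1) ω * v (X (n + 1) ω) ∂P =
      ∫⁻ ω in A, pathWeight ψ X T n ω * stepGain M ψ v (X n ω) ∂P := by
  have hA' := h.pastSigma_le n _ hA
  have key := h.lintegral_step n
    (U := A.indicator (pathWeight ψ X T n)) ((measurable_pathWeight hψ n).indicator hA) hψ v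
  rw [← lintegral_indicator hA', ← lintegral_indicator hA']
  convert key using 2
  · ext ω
    by_cases hω : ω ∈ A
    · simp [hω, pathWeight, Finset.prod_range_succ]
    · simp [hω]
  · ext ω
    by_cases hω : ω ∈ A
    · simp [hω, stepGain]
    · simp [hω]

/-- If the n-th epoch is at most τ, then either the n-th sojourn crosses τ or the next epoch is
still at most τ. The event being split belongs to the past, so the one-step relation applies on it.
-/
theorem IsSemiMarkov.setLIntegral_epoch_le_split (h : IsSemiMarkov M P X T)
    (hd : ∀ i, ∀ᵐ y ∂M.dwell i, 0 ≤ y) {ψ : ι → ℝ → ENNReal}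
    (hψ : ∀ i, Measurable (ψ i)) (v : ι → ENNReal) (τ : ℝ) (n : ℕ) :
    ∫⁻ ω in exitSet T τ n, pathWeight ψ X T (n + 1) ω * v (X (n + 1) ω) ∂P +
      ∫⁻ ω in {ω | epoch T (n + 1) ω ≤ τ}, pathWeight ψ X T (n + 1) ω * v (X (n + 1) ω) ∂P =
      ∫⁻ ω in {ω | epoch T n ω ≤ τ}, pathWeight ψ X T n ω * stepGain M ψ v (X n ω) ∂P := by
  have hm : MeasurableSet[pastSigma X T n] {ω | epoch T n ω ≤ τ} :=
    measurableSet_le (measurable_past_epoch n) measurable_const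
  have hB : MeasurableSet {ω | epoch T (n + 1) ω ≤ τ} :=
    measurableSet_le (h.measurable_epoch (n + 1)) measurable_const
  rw [← h.setLIntegral_step hψ v n hm,
    ← lintegral_inter_add_sdiff _ {ω | epoch T n ω ≤ τ} hB, add_comm]
  congr 1
  · refine setLIntegral_congr ?_
    filter_upwards [h.ae_dwell_nonneg hd] with ω hω
    have h1 : epoch T n ω ≤ epoch T (n + 1) ω := epoch_mono hω n.le_succ
    refine propext ⟨fun h2 => ⟨h1.trans h2, h2⟩, fun h2 => h2.2⟩
  · congr 2
    ext ω
    simp [exitSet]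

/-- Optional stopping for a supermartingale: the splitting identity telescopes. The second term
collects the paths that have not crossed τ after N sojourns. -/
theorem IsSemiMarkov.sum_exit_le (h : IsSemiMarkov M P X T)
    (hd : ∀ i, ∀ᵐ y ∂M.dwell i, 0 ≤ y) {ψ : ι → ℝ → ENNReal}
    (hψ : ∀ i, Measurable (ψ i)) (v : ι → ENNReal) (hv : ∀ i, stepGain M ψ v i ≤ v i)
    (τ : ℝ) (N : ℕ) :
    ∑ n ∈ Finset.range N,
        ∫⁻ ω in exitSet T τ n, pathWeight ψ X T (n + 1) ω * v (X (n + 1) ω) ∂P +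
      ∫⁻ ω in {ω | epoch T N ω ≤ τ}, pathWeight ψ X T N ω * v (X N ω) ∂P ≤
      ∫⁻ ω, v (X 0 ω) ∂P := by
  induction N with
  | zero =>
    simp only [Finset.range_zero, Finset.sum_empty, zero_add, pathWeight, Finset.prod_empty,
      one_mul]
    exact setLIntegral_le_lintegral _ _
  | succ N ih =>
    rw [Finset.sum_range_succ, add_assoc, h.setLIntegral_epoch_le_split hd hψ]
    refine le_trans ?_ ih
    gcongr
    exact hv _

theorem IsSemiMarkov.le_sum_exit (h : IsSemiMarkov M P X T)
    (hd : ∀ i, ∀ᵐ y ∂M.dwell i, 0 ≤ y) {ψ : ι → ℝ → ENNReal}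
    (hψ : ∀ i, Measurable (ψ i)) (v : ι → ENNReal) (hv : ∀ i, v i ≤ stepGain M ψ v i)
    {τ : ℝ} (hτ : 0 ≤ τ) (N : ℕ) :
    ∫⁻ ω, v (X 0 ω) ∂P ≤ ∑ n ∈ Finset.range N,
        ∫⁻ ω in exitSet T τ n, pathWeight ψ X T (n + 1) ω * v (X (n + 1) ω) ∂P +
      ∫⁻ ω in {ω | epoch T N ω ≤ τ}, pathWeight ψ X T N ω * v (X N ω) ∂P := by
  induction N with
  | zero =>
    simp [pathWeight, epoch, hτ]
  | succ N ih =>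
    rw [Finset.sum_range_succ, add_assoc, h.setLIntegral_epoch_le_split hd hψ]
    refine ih.trans ?_
    gcongr
    exact hv _

theorem IsSemiMarkov.lintegral_pathWeight_le (h : IsSemiMarkov M P X T) {ψ : ι → ℝ → ENNReal}
    (hψ : ∀ i, Measurable (ψ i)) (v : ι → ENNReal) {r : ENNReal} (hr : r ≠ ⊤)
    (hv : ∀ i, stepGain M ψ v i ≤ r * v i) (N : ℕ) :
    ∫⁻ ω, pathWeight ψ X T N ω * v (X N ω) ∂P ≤ r ^ N * ∫⁻ ω, v (X 0 ω) ∂P := by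
  induction N with
  | zero => simp [pathWeight]
  | succ N ih =>
    have := h.setLIntegral_step hψ v N (@MeasurableSet.univ _ (pastSigma X T N))
    rw [Measure.restrict_univ] at this
    rw [this, pow_succ', mul_assoc]
    calc ∫⁻ ω, pathWeight ψ X T N ω * stepGain M ψ v (X N ω) ∂P
        ≤ ∫⁻ ω, r * (pathWeight ψ X T N ω * v (X N ω)) ∂P := by
          refine lintegral_mono fun ω => ?_
          rw [mul_left_comm]
          gcongr
          exact hv _
      _ = r * ∫⁻ ω, pathWeight ψ X T N ω * v (X N ω) ∂P := lintegral_const_mul' _ _ hr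
      _ ≤ _ := by gcongr

/-- If discounting time yields a uniform contraction, then the epochs tend to infinity. -/
theorem IsSemiMarkov.tendsto_measure_epoch_le (h : IsSemiMarkov M P X T) {v : ι → ℝ}
    (hv : ∀ i, 0 < v i) {r : ℝ} (hr0 : 0 ≤ r) (hr1 : r < 1)
    (hgain : ∀ i, stepGain M (fun _ y => ENNReal.ofReal (Real.exp (-y)))
      (fun j => ENNReal.ofReal (v j)) i ≤ ENNReal.ofReal (r * v i)) (τ : ℝ) :
    Tendsto (fun N => P {ω | epoch T N ω ≤ τ}) atTop (𝓝 0) := by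
  obtain ⟨a, b, ha, hb, hab⟩ := exists_pos_bounds hv
  have hψ : ∀ _ : ι, Measurable fun y : ℝ => ENNReal.ofReal (Real.exp (-y)) :=
    fun _ => by fun_prop
  have hW : ∀ N ω, pathWeight (fun (_ : ι) y => ENNReal.ofReal (Real.exp (-y))) X T N ω =
      ENNReal.ofReal (Real.exp (-epoch T N ω)) := by
    intro N ω
    rw [pathWeight, ← ENNReal.ofReal_prod_of_nonneg fun _ _ => (Real.exp_pos _).le,
      ← Real.exp_sum, Finset.sum_neg_distrib, epoch]
  set c := ENNReal.ofReal (Real.exp (-τ) * a) with hc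
  have hc0 : c ≠ 0 := by
    rw [hc, Ne, ENNReal.ofReal_eq_zero, not_le]
    positivity
  -- Markov's inequality: on this event the discounted potential is at least `c`, while its
  -- expectation is at most b rᴺ.
  have bound : ∀ N, P {ω | epoch T N ω ≤ τ} ≤ ENNReal.ofReal r ^ N * (ENNReal.ofReal b / c) := by
    intro N
    rw [← mul_div_assoc, ENNReal.le_div_iff_mul_le (Or.inl hc0) (Or.inl ENNReal.ofReal_ne_top),
      mul_comm, ← setLIntegral_const]
    calc ∫⁻ _ in {ω | epoch T N ω ≤ τ}, c ∂P
        ≤ ∫⁻ ω in {ω | epoch T N ω ≤ τ},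
            pathWeight (fun (_ : ι) y => ENNReal.ofReal (Real.exp (-y))) X T N ω *
              ENNReal.ofReal (v (X N ω)) ∂P := by
          refine setLIntegral_mono' (measurableSet_le (h.measurable_epoch N) measurable_const) ?_
          intro ω hω
          have hω' : epoch T N ω ≤ τ := hω
          rw [hW, ← ENNReal.ofReal_mul (Real.exp_pos _).le]
          refine ENNReal.ofReal_le_ofReal ?_
          gcongr
          exact (hab _).1
      _ ≤ _ := setLIntegral_le_lintegral _ _
      _ ≤ ENNReal.ofReal r ^ N * ∫⁻ ω, ENNReal.ofReal (v (X 0 ω)) ∂P := by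
          refine h.lintegral_pathWeight_le hψ (fun j => ENNReal.ofReal (v j))
            ENNReal.ofReal_ne_top (fun i => ?_) N
          rw [← ENNReal.ofReal_mul hr0]
          exact hgain i
      _ ≤ ENNReal.ofReal r ^ N * ENNReal.ofReal b := by
          gcongr
          calc ∫⁻ ω, ENNReal.ofReal (v (X 0 ω)) ∂P ≤ ∫⁻ _, ENNReal.ofReal b ∂P :=
                lintegral_mono fun ω => ENNReal.ofReal_le_ofReal (hab _).2
            _ = ENNReal.ofReal b := by simp
  have lim : Tendsto (fun N => ENNReal.ofReal r ^ N * (ENNReal.ofReal b / c)) atTop (𝓝 0) := by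
    have h1 := ENNReal.tendsto_pow_atTop_nhds_zero_of_lt_one (r := ENNReal.ofReal r)
      (by simpa using hr1)
    have h2 := ENNReal.Tendsto.mul_const (b := ENNReal.ofReal b / c) h1
      (Or.inr (ENNReal.div_ne_top ENNReal.ofReal_ne_top hc0))
    simpa using h2
  exact tendsto_of_tendsto_of_tendsto_of_le_of_le tendsto_const_nhds lim (fun _ => zero_le) bound

omit [Fintype ι] [IsProbabilityMeasure P] [∀ i, IsProbabilityMeasure (M.dwell i)] in
theorem ae_exists_lt_epoch {τ : ℝ}
    (hlim : Tendsto (fun N => P {ω | epoch T N ω ≤ τ}) atTop (𝓝 0)) :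
    ∀ᵐ ω ∂P, ∃ n, τ < epoch T n ω := by
  rw [ae_iff]
  refine le_antisymm (ge_of_tendsto' hlim fun N => measure_mono fun ω hω => ?_) zero_le
  have : ∀ n, epoch T n ω ≤ τ := by simpa using hω
  exact this N

end Stopping

/-! ### From exponential bounds to the effective capacity -/

/-- Exponential two-sided bounds determine the effective capacity. -/
theorem tendsto_neg_log_div {g : ℝ → ℝ} {θ C : ℝ} (hθ : 0 < θ)
    (hup : ∃ A > 0, ∀ t ≥ 0, g t ≤ A * Real.exp (-(θ * C * t)))
    (hlow : ∀ C' > C, ∃ c > 0, ∀ t ≥ 0, c * Real.exp (-(θ * C' * t)) ≤ g t) :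
    Tendsto (fun t : ℝ => -(1 / (θ * t) * Real.log (g t))) atTop (𝓝 C) := by
  have hlim : ∀ a b : ℝ, Tendsto (fun t : ℝ => b - a / (θ * t)) atTop (𝓝 b) := by
    intro a b
    have h1 : Tendsto (fun t : ℝ => a / (θ * t)) atTop (𝓝 0) :=
      tendsto_const_nhds.div_atTop (tendsto_id.const_mul_atTop hθ)
    simpa using tendsto_const_nhds (x := b).sub h1
  obtain ⟨A, hA, hup⟩ := hup
  rw [tendsto_order]
  constructor
  · intro b hb
    filter_upwards [(hlim (Real.log A) C).eventually (lt_mem_nhds hb), eventually_gt_atTop 0]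
      with t ht ht0
    refine ht.trans_le ?_
    -- Any exponent above `C` would do: the lower bound serves only to make `g t` positive, so that
    -- the logarithm is monotone there.
    obtain ⟨c, hc, hcl⟩ := hlow (C + 1) (by linarith)
    have hg : 0 < g t := lt_of_lt_of_le (by positivity) (hcl t ht0.le)
    have h1 : Real.log (g t) ≤ Real.log A - θ * C * t := by
      refine (Real.log_le_log hg (hup t ht0.le)).trans_eq ?_
      rw [Real.log_mul hA.ne' (Real.exp_pos _).ne', Real.log_exp]
      ring
    have h2 : 1 / (θ * t) * Real.log (g t) ≤ 1 / (θ * t) * (Real.log A - θ * C * t) := by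
      gcongr
    have h3 : 1 / (θ * t) * (Real.log A - θ * C * t) = Real.log A / (θ * t) - C := by
      field_simp
    linarith
  · intro b hb
    obtain ⟨C', hC, hCb⟩ := exists_between hb
    obtain ⟨c, hc, hcl⟩ := hlow C' hC
    filter_upwards [(hlim (Real.log c) C').eventually (gt_mem_nhds hCb), eventually_gt_atTop 0]
      with t ht ht0
    refine lt_of_le_of_lt ?_ ht
    have h1 : Real.log c - θ * C' * t ≤ Real.log (g t) := by
      refine le_trans (le_of_eq ?_) (Real.log_le_log (by positivity) (hcl t ht0.le))
      rw [Real.log_mul hc.ne' (Real.exp_pos _).ne', Real.log_exp]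
      ring
    have h2 : 1 / (θ * t) * (Real.log c - θ * C' * t) ≤ 1 / (θ * t) * Real.log (g t) := by
      gcongr
    have h3 : 1 / (θ * t) * (Real.log c - θ * C' * t) = Real.log c / (θ * t) - C' := by
      field_simp
    linarith

section Capacity

variable {ι : Type} [Fintype ι] {Ω : Type*} [MeasurableSpace Ω] {M : SemiMarkovModel ι}
  {P : Measure Ω} {X : ℕ → Ω → ι} {T : ℕ → Ω → ℝ}

/-- The partial sums of the defining series are measurable, and almost surely constant from some
index on, since sojourns starting after τ contribute zero. -/
theorem IsSemiMarkov.aemeasurable_service (h : IsSemiMarkov M P X T)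
    (hd : ∀ i, ∀ᵐ y ∂M.dwell i, 0 ≤ y) {τ : ℝ} (hτ : 0 ≤ τ)
    (hexit : ∀ᵐ ω ∂P, ∃ n, τ < epoch T n ω) : AEMeasurable (service M X T τ) P := by
  refine aemeasurable_of_tendsto_metrizable_ae atTop (f := fun (N : ℕ) ω =>
    ∑ k ∈ Finset.range N,
      M.rate (X k ω) * (min τ (epoch T (k + 1) ω) - min τ (epoch T k ω))) (fun N => ?_) ?_
  · refine (Finset.measurable_fun_sum _ fun k _ => Measurable.mul ?_ ?_).aemeasurable
    · exact measurable_of_state (h.measurable_state k) (F := fun i _ => M.rate i)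
        fun _ => measurable_const
    · have := h.measurable_epoch k
      have := h.measurable_epoch (k + 1)
      fun_prop
  · filter_upwards [h.ae_dwell_nonneg hd, hexit] with ω hT hω
    obtain ⟨n, hn⟩ := exists_mem_exitSet hτ hω
    rw [service_eq hT hn]
    exact (hasSum_service hT hn).tendsto_sum_nat

theorem IsSemiMarkov.sum_exitSet_le (h : IsSemiMarkov M P X T)
    (hd : ∀ i, ∀ᵐ y ∂M.dwell i, 0 ≤ y) (τ : ℝ) (N : ℕ) (f : Ω → ENNReal) :
    ∑ n ∈ Finset.range N, ∫⁻ ω in exitSet T τ n, f ω ∂P ≤ ∫⁻ ω, f ω ∂P := by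
  have hdis : ∀ m n, m < n → AEDisjoint P (exitSet T τ m) (exitSet T τ n) := by
    intro m n hmn
    refine measure_mono_null (fun ω hω => ?_) (h.ae_dwell_nonneg hd)
    exact fun hT => notMem_exitSet_of_lt hmn hT hω.1 hω.2
  rw [← lintegral_biUnion_finset₀ (t := exitSet T τ) (s := Finset.range N) ?_
    fun n _ => (h.measurableSet_exitSet τ n).nullMeasurableSet]
  · exact setLIntegral_le_lintegral _ _
  · intro m _ n _ hmn
    rcases lt_or_gt_of_ne hmn with hlt | hlt
    · exact hdis m n hlt
    · exact (hdis n m hlt).symm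

variable [IsProbabilityMeasure P] [∀ i, IsProbabilityMeasure (M.dwell i)]

omit [Fintype ι] in
theorem measurable_expWeight (M : SemiMarkovModel ι) (a θ : ℝ) (i : ι) :
    Measurable fun y : ℝ => ENNReal.ofReal (Real.exp (a * y - θ * (M.rate i * y))) := by
  fun_prop

/-- Chernoff upper bound from an excessive potential. -/
theorem IsSemiMarkov.exists_lintegral_service_le (h : IsSemiMarkov M P X T) {θ C B : ℝ}
    (hθ : 0 < θ) (hC : 0 ≤ C) (hr : ∀ i, 0 ≤ M.rate i)
    (hd : ∀ i, ∀ᵐ y ∂M.dwell i, 0 ≤ y) (hB : ∀ i, ∀ᵐ y ∂M.dwell i, M.rate i * y ≤ B)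
    (hexit : ∀ τ, ∀ᵐ ω ∂P, ∃ n, τ < epoch T n ω) {v : ι → ℝ} (hv : ∀ i, 0 < v i)
    (hgain : ∀ i, stepGain M (fun i y => ENNReal.ofReal
        (Real.exp (θ * C * y - θ * (M.rate i * y)))) (fun j => ENNReal.ofReal (v j)) i ≤
      ENNReal.ofReal (v i)) :
    ∃ A > 0, ∀ τ ≥ 0, ∫⁻ ω, ENNReal.ofReal (Real.exp (-θ * service M X T τ ω)) ∂P ≤
      ENNReal.ofReal (A * Real.exp (-(θ * C * τ))) := by
  obtain ⟨a, b, ha, hb, hab⟩ := exists_pos_bounds hv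
  refine ⟨b * Real.exp (θ * B) / a, by positivity, fun τ hτ => ?_⟩
  set f : Ω → ENNReal := fun ω => ENNReal.ofReal (Real.exp (-θ * service M X T τ ω)) with hf
  -- At the exit the epoch exceeds τ, and the service exceeds S(τ) by at most `B`. So `c` times
  -- exp(-θS(τ)) is below the stopped weight times potential.
  set c := a * Real.exp (θ * C * τ - θ * B) with hc
  have hc0 : 0 < c := by positivity
  have hT := h.ae_dwell_nonneg hd
  have hBT : ∀ᵐ ω ∂P, ∀ n, M.rate (X n ω) * T n ω ≤ B := ae_all_iff.2 fun n => h.ae_dwell hB n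
  have hsum : ∀ N, ∑ n ∈ Finset.range N, ∫⁻ ω in exitSet T τ n, f ω ∂P ≤
      ENNReal.ofReal (b / c) := by
    intro N
    rw [ENNReal.ofReal_div_of_pos hc0, ENNReal.le_div_iff_mul_le
      (Or.inl (by simpa using hc0)) (Or.inl ENNReal.ofReal_ne_top), Finset.sum_mul]
    calc ∑ n ∈ Finset.range N, (∫⁻ ω in exitSet T τ n, f ω ∂P) * ENNReal.ofReal c
        ≤ ∑ n ∈ Finset.range N, ∫⁻ ω in exitSet T τ n, pathWeight (fun i y => ENNReal.ofReal
            (Real.exp (θ * C * y - θ * (M.rate i * y)))) X T (n + 1) ω *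
              ENNReal.ofReal (v (X (n + 1) ω)) ∂P := by
          refine Finset.sum_le_sum fun n _ => ?_
          rw [← lintegral_mul_const' _ _ ENNReal.ofReal_ne_top]
          refine setLIntegral_mono_ae' (h.measurableSet_exitSet τ n) ?_
          filter_upwards [hT, hBT] with ω hTω hBω hn
          rw [pathWeight_exp, ← ENNReal.ofReal_mul (Real.exp_pos _).le,
            ← ENNReal.ofReal_mul (Real.exp_pos _).le]
          refine ENNReal.ofReal_le_ofReal ?_
          rw [hc, mul_comm a, ← mul_assoc, ← Real.exp_add]
          have h1 := cumService_le hr hTω (hBω n) hn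
          have h2 : θ * cumService M X T (n + 1) ω ≤ θ * (service M X T τ ω + B) := by gcongr
          have h3 : θ * C * τ ≤ θ * C * epoch T (n + 1) ω := by
            have := hn.2.le
            gcongr
          gcongr
          · linarith
          · exact (hab _).1
      _ ≤ ∫⁻ ω, ENNReal.ofReal (v (X 0 ω)) ∂P :=
          le_self_add.trans (h.sum_exit_le hd (measurable_expWeight M _ _)
            (fun j => ENNReal.ofReal (v j)) hgain τ N)
      _ ≤ ∫⁻ _, ENNReal.ofReal b ∂P := lintegral_mono fun ω => ENNReal.ofReal_le_ofReal (hab _).2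
      _ = ENNReal.ofReal b := by simp
  have hcover : ∀ᵐ ω ∂P, ω ∈ ⋃ n, exitSet T τ n := by
    filter_upwards [hexit τ] with ω hω
    exact Set.mem_iUnion.2 (exists_mem_exitSet hτ hω)
  calc ∫⁻ ω, f ω ∂P = ∫⁻ ω in ⋃ n, exitSet T τ n, f ω ∂P := by
        rw [Measure.restrict_eq_self_of_ae_mem hcover]
    _ ≤ ∑' n, ∫⁻ ω in exitSet T τ n, f ω ∂P := lintegral_iUnion_le _ _
    _ ≤ ENNReal.ofReal (b / c) := ENNReal.tsum_le_of_sum_range_le hsum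
    _ = _ := by
      congr 1
      rw [hc, Real.exp_sub, Real.exp_neg]
      field_simp

/-- Lower bound from a potential that increases already over bounded sojourns. -/
theorem IsSemiMarkov.exists_le_lintegral_service (h : IsSemiMarkov M P X T) {θ C t₀ : ℝ}
    (hθ : 0 < θ) (hC : 0 ≤ C) (hr : ∀ i, 0 ≤ M.rate i)
    (hd : ∀ i, ∀ᵐ y ∂M.dwell i, 0 ≤ y)
    (hlim : ∀ τ, Tendsto (fun N => P {ω | epoch T N ω ≤ τ}) atTop (𝓝 0))
    {v : ι → ℝ} (hv : ∀ i, 0 < v i)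
    (hgain : ∀ i, ENNReal.ofReal (v i) ≤ stepGain M (fun i => (Set.Iic t₀).indicator fun y =>
      ENNReal.ofReal (Real.exp (θ * C * y - θ * (M.rate i * y)))) (fun j => ENNReal.ofReal (v j))
        i) :
    ∃ c > 0, ∀ τ ≥ 0, ENNReal.ofReal (c * Real.exp (-(θ * C * τ))) ≤
      ∫⁻ ω, ENNReal.ofReal (Real.exp (-θ * service M X T τ ω)) ∂P := by
  obtain ⟨a, b, ha, hb, hab⟩ := exists_pos_bounds hv
  refine ⟨a / (b * Real.exp (θ * C * t₀)), by positivity, fun τ hτ => ?_⟩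
  set f : Ω → ENNReal := fun ω => ENNReal.ofReal (Real.exp (-θ * service M X T τ ω)) with hf
  set ψ : ι → ℝ → ENNReal := fun i => (Set.Iic t₀).indicator fun y =>
      ENNReal.ofReal (Real.exp (θ * C * y - θ * (M.rate i * y))) with hψ
  have hψm : ∀ i, Measurable (ψ i) := fun i =>
    (measurable_expWeight M _ _ i).indicator measurableSet_Iic
  have hψle : ∀ n ω, pathWeight ψ X T n ω ≤
      ENNReal.ofReal (Real.exp (θ * C * epoch T n ω - θ * cumService M X T n ω)) := by
    intro n ω
    rw [← pathWeight_exp]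
    exact Finset.prod_le_prod' fun k _ => Set.indicator_le_self _ _ _
  have hT := h.ae_dwell_nonneg hd
  -- A crossing sojourn of nonzero weight has length at most t₀, so the exit epoch is at most τ +
  -- t₀.
  set c := b * Real.exp (θ * C * (τ + t₀)) with hc
  have hc0 : 0 < c := by positivity
  have bound : ∀ N, ENNReal.ofReal a ≤ (∫⁻ ω, f ω ∂P) * ENNReal.ofReal c +
      ENNReal.ofReal (b * Real.exp (θ * C * τ)) * P {ω | epoch T N ω ≤ τ} := by
    intro N
    calc ENNReal.ofReal a = ∫⁻ _, ENNReal.ofReal a ∂P := by simp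
      _ ≤ ∫⁻ ω, ENNReal.ofReal (v (X 0 ω)) ∂P :=
          lintegral_mono fun ω => ENNReal.ofReal_le_ofReal (hab _).1
      _ ≤ _ := h.le_sum_exit hd hψm (fun j => ENNReal.ofReal (v j)) hgain hτ N
      _ ≤ ∑ n ∈ Finset.range N, (∫⁻ ω in exitSet T τ n, f ω ∂P) * ENNReal.ofReal c +
          ∫⁻ _ in {ω | epoch T N ω ≤ τ}, ENNReal.ofReal (b * Real.exp (θ * C * τ)) ∂P := by
        refine add_le_add (Finset.sum_le_sum fun n _ => ?_) ?_
        · rw [← lintegral_mul_const' _ _ ENNReal.ofReal_ne_top]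
          refine setLIntegral_mono_ae' (h.measurableSet_exitSet τ n) ?_
          filter_upwards [hT] with ω hTω hn
          by_cases htn : T n ω ≤ t₀
          · rw [← ENNReal.ofReal_mul (Real.exp_pos _).le]
            refine (mul_le_mul_left (hψle _ _) _).trans ?_
            rw [← ENNReal.ofReal_mul (Real.exp_pos _).le]
            refine ENNReal.ofReal_le_ofReal ?_
            rw [hc, mul_comm b, ← mul_assoc, ← Real.exp_add]
            have h1 : θ * service M X T τ ω ≤ θ * cumService M X T (n + 1) ω := by
              have := service_le (X := X) hr hTω hn
              gcongr
            have h2 : θ * C * epoch T (n + 1) ω ≤ θ * C * (τ + t₀) := by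
              have := hn.1
              rw [epoch_succ]
              gcongr
            gcongr
            · exact (hv _).le
            · linarith
            · exact (hab _).2
          · have : pathWeight ψ X T (n + 1) ω = 0 := by
              rw [pathWeight, Finset.prod_range_succ]
              simp [hψ, htn]
            simp [this]
        · refine setLIntegral_mono_ae'
            (measurableSet_le (h.measurable_epoch N) measurable_const) ?_
          filter_upwards [hT] with ω hTω hn
          refine (mul_le_mul_left (hψle _ _) _).trans ?_
          rw [← ENNReal.ofReal_mul (Real.exp_pos _).le, mul_comm b]
          refine ENNReal.ofReal_le_ofReal ?_
          have h1 : 0 ≤ θ * cumService M X T N ω :=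
            mul_nonneg hθ.le (cumService_nonneg hr hTω N)
          have h2 : θ * C * epoch T N ω ≤ θ * C * τ := by
            have : epoch T N ω ≤ τ := hn
            gcongr
          gcongr
          · exact (hv _).le
          · linarith
          · exact (hab _).2
      _ ≤ _ := by
        rw [← Finset.sum_mul, setLIntegral_const]
        gcongr
        exact h.sum_exitSet_le hd τ N f
  -- The contribution of the paths that have not yet crossed τ vanishes as N tends to infinity.
  have hfin : ENNReal.ofReal a ≤ (∫⁻ ω, f ω ∂P) * ENNReal.ofReal c := by
    have h1 := (ENNReal.Tendsto.const_mul (a := ENNReal.ofReal (b * Real.exp (θ * C * τ)))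
      (hlim τ) (Or.inr ENNReal.ofReal_ne_top)).const_add ((∫⁻ ω, f ω ∂P) * ENNReal.ofReal c)
    rw [mul_zero, add_zero] at h1
    exact ge_of_tendsto' h1 bound
  rw [← ENNReal.div_le_iff_le_mul (Or.inl (by simpa using hc0)) (Or.inl ENNReal.ofReal_ne_top),
    ← ENNReal.ofReal_div_of_pos hc0] at hfin
  refine le_trans (le_of_eq ?_) hfin
  congr 1
  rw [hc, mul_add, Real.exp_add, Real.exp_neg]
  field_simp

/-- The effective capacity of a semi-Markov model, from potentials for the exponentially
tilted process. -/
theorem IsSemiMarkov.isEffectiveCapacity (h : IsSemiMarkov M P X T) {θ C B : ℝ}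
    (hθ : 0 < θ) (hC : 0 ≤ C) (hr : ∀ i, 0 ≤ M.rate i)
    (hd : ∀ i, ∀ᵐ y ∂M.dwell i, 0 ≤ y) (hB : ∀ i, ∀ᵐ y ∂M.dwell i, M.rate i * y ≤ B)
    (hnon : ∃ v : ι → ℝ, (∀ i, 0 < v i) ∧ ∃ r : ℝ, 0 ≤ r ∧ r < 1 ∧ ∀ i,
      stepGain M (fun _ y => ENNReal.ofReal (Real.exp (-y))) (fun j => ENNReal.ofReal (v j)) i ≤
        ENNReal.ofReal (r * v i))
    (hup : ∃ v : ι → ℝ, (∀ i, 0 < v i) ∧ ∀ i, stepGain M (fun i y => ENNReal.ofReal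
        (Real.exp (θ * C * y - θ * (M.rate i * y)))) (fun j => ENNReal.ofReal (v j)) i ≤
      ENNReal.ofReal (v i))
    (hlow : ∀ C' > C, ∃ v : ι → ℝ, (∀ i, 0 < v i) ∧ ∃ t₀ : ℝ, ∀ i, ENNReal.ofReal (v i) ≤
      stepGain M (fun i => (Set.Iic t₀).indicator fun y =>
        ENNReal.ofReal (Real.exp (θ * C' * y - θ * (M.rate i * y))))
          (fun j => ENNReal.ofReal (v j)) i) :
    IsEffectiveCapacity P (service M X T) θ C := by
  obtain ⟨w, hw, r, hr0, hr1, hgain⟩ := hnon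
  have hlim := h.tendsto_measure_epoch_le hw hr0 hr1 hgain
  have hexit : ∀ τ, ∀ᵐ ω ∂P, ∃ n, τ < epoch T n ω := fun τ => ae_exists_lt_epoch (hlim τ)
  have hint : ∀ τ ≥ 0, ∫ ω, Real.exp (-θ * service M X T τ ω) ∂P =
      (∫⁻ ω, ENNReal.ofReal (Real.exp (-θ * service M X T τ ω)) ∂P).toReal := by
    intro τ hτ
    refine integral_eq_lintegral_of_nonneg_ae (ae_of_all _ fun ω => (Real.exp_pos _).le) ?_
    have := h.aemeasurable_service hd hτ (hexit τ)
    exact (Real.measurable_exp.comp_aemeasurable (this.const_mul (-θ))).aestronglyMeasurable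
  obtain ⟨v, hv, hvg⟩ := hup
  obtain ⟨A, hA, hAb⟩ := h.exists_lintegral_service_le hθ hC hr hd hB hexit hv hvg
  refine tendsto_neg_log_div hθ ⟨A, hA, fun τ hτ => ?_⟩ fun C' hC' => ?_
  · rw [hint τ hτ]
    exact ENNReal.toReal_le_of_le_ofReal (by positivity) (hAb τ hτ)
  · obtain ⟨v', hv', t₀, hvg'⟩ := hlow C' hC'
    obtain ⟨c, hc, hcb⟩ :=
      h.exists_le_lintegral_service hθ (hC.trans hC'.le) hr hd hlim hv' hvg'
    refine ⟨c, hc, fun τ hτ => ?_⟩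
    rw [hint τ hτ]
    refine (ENNReal.ofReal_le_iff_le_toReal ?_).1 (hcb τ hτ)
    exact ((hAb τ hτ).trans_lt ENNReal.ofReal_lt_top).ne

end Capacity

/-! ### Spectral radii and characteristic equations -/

theorem exists_dominant_root {b c : ℝ} (hb : 0 ≤ b) (hc : 0 ≤ c) :
    ∃ r : ℝ, 0 ≤ r ∧ r ^ 2 = b * r + c ∧ (r = 1 ↔ b + c = 1) ∧
      ∀ x : ℝ, 0 ≤ x → x ^ 2 ≤ b * x + c → x ≤ r := by
  set s := Real.sqrt (b ^ 2 + 4 * c) with hs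
  have hs2 : s ^ 2 = b ^ 2 + 4 * c := Real.sq_sqrt (by positivity)
  have hs0 : 0 ≤ s := Real.sqrt_nonneg _
  have hbs : b ≤ s := by
    refine Real.le_sqrt_of_sq_le ?_
    linarith
  refine ⟨(b + s) / 2, by positivity, by linear_combination hs2 / 4, ⟨fun h => ?_, fun h => ?_⟩,
    fun x hx hxx => ?_⟩
  · have : s = 2 - b := by linarith
    rw [this] at hs2
    linarith
  · have hs' : s ^ 2 = (2 - b) ^ 2 := by
      rw [hs2]
      linear_combination 4 * h
    have := (sq_eq_sq₀ hs0 (by linarith)).1 hs'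
    rw [this]
    ring
  · by_contra! hlt
    nlinarith

/-- If the nonzero eigenvalues are the nonzero roots of `k² = b k + c` with nonnegative
coefficients, then the spectral radius is `1` if and only if `1` is an eigenvalue. -/
theorem spectralRadius_eq_one_iff {A : Type*} [Ring A] [Algebra ℂ A] {a : A} {b c : ℝ}
    (hb : 0 ≤ b) (hc : 0 ≤ c) (h : ∀ k : ℂ, k ≠ 0 → (k ∈ spectrum ℂ a ↔ k ^ 2 = b * k + c)) :
    spectralRadius ℂ a = 1 ↔ b + c = 1 := by
  obtain ⟨r, hr0, hr, hr1, hmax⟩ := exists_dominant_root hb hc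
  have key : spectralRadius ℂ a = ENNReal.ofReal r := by
    refine le_antisymm (iSup₂_le fun k hk => ?_) ?_
    · have hk' : ‖k‖ ≤ r := by
        rcases eq_or_ne k 0 with rfl | hk0
        · simpa using hr0
        refine hmax _ (norm_nonneg k) ?_
        have := (h k hk0).1 hk
        -- Nonnegative coefficients turn the triangle inequality into the same quadratic inequality
        -- for `‖k‖`, so the dominant root bounds every eigenvalue.
        calc ‖k‖ ^ 2 = ‖(b : ℂ) * k + c‖ := by rw [← norm_pow, this]
          _ ≤ ‖(b : ℂ) * k‖ + ‖(c : ℂ)‖ := norm_add_le _ _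
          _ = b * ‖k‖ + c := by
            rw [norm_mul, Complex.norm_of_nonneg hb, Complex.norm_of_nonneg hc]
      rw [← enorm_eq_nnnorm, ← ofReal_norm]
      exact ENNReal.ofReal_le_ofReal hk'
    · rcases hr0.eq_or_lt with h0 | h0
      · simp [← h0]
      have hmem : (r : ℂ) ∈ spectrum ℂ a := by
        rw [h _ (by exact_mod_cast h0.ne')]
        exact_mod_cast hr
      have : (‖(r : ℂ)‖₊ : ENNReal) ≤ spectralRadius ℂ a :=
        le_iSup₂ (f := fun k (_ : k ∈ spectrum ℂ a) => (‖k‖₊ : ENNReal)) (r : ℂ) hmem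
      refine le_trans (le_of_eq ?_) this
      rw [← enorm_eq_nnnorm, ← ofReal_norm, Complex.norm_of_nonneg hr0]
  rw [key, ENNReal.ofReal_eq_one, hr1]

theorem mem_spectrum_iff_det {n : Type*} [Fintype n] [DecidableEq n] (A : Matrix n n ℂ) (k : ℂ) :
    k ∈ spectrum ℂ A ↔ (algebraMap ℂ (Matrix n n ℂ) k - A).det = 0 := by
  rw [spectrum.mem_iff, Matrix.isUnit_iff_isUnit_det, isUnit_iff_ne_zero, not_not]

theorem twoState_phi_eq_one_iff (Tf R : ℝ) (μ₃ : Measure ℝ) (c u : ℝ) :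
    (twoState Tf R μ₃).phi c u = 1 ↔
      Real.exp ((R * c - u) * Tf) * mgf id μ₃ (-u) = 1 := by
  have hm : 0 ≤ mgf id μ₃ (-u) := mgf_nonneg
  rw [SemiMarkovModel.phi, spectralRadius_eq_one_iff (b := 0)
    (c := Real.exp ((R * c - u) * Tf) * mgf id μ₃ (-u)) le_rfl (by positivity), zero_add]
  intro k _
  have hM : (twoState Tf R μ₃).matH c u =
      !![0, Real.exp ((R * c - u) * Tf); mgf id μ₃ (-u), 0] := by
    ext i j
    rw [SemiMarkovModel.matH, Matrix.mul_diagonal]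
    fin_cases i <;> fin_cases j <;> simp [twoState, mgf]
  rw [mem_spectrum_iff_det, Matrix.det_fin_two, hM]
  simp [Matrix.algebraMap_matrix_apply, sub_eq_zero, sq]

/-- The last three rows of P coincide, so H has rank at most two and its characteristic polynomial
is k²(k² - bk - c). -/
theorem fourState_phi_eq_one_iff (K : ℕ) {p ε Tf R : ℝ} (hp0 : 0 ≤ p) (hp1 : p ≤ 1)
    (hε0 : 0 ≤ ε) (hε1 : ε ≤ 1) (μ₁ μ₂ : Measure ℝ) (c u : ℝ) :
    (fourState K p ε Tf R μ₁ μ₂).phi c u = 1 ↔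
      p ^ K * mgf id μ₂ (-u) + (1 - p ^ K) * mgf id μ₁ (-u) *
        (Real.exp ((R * c - u) * Tf) * (1 - ε) + Real.exp (-u * Tf) * ε) = 1 := by
  have hm1 : 0 ≤ mgf id μ₁ (-u) := mgf_nonneg
  have hm2 : 0 ≤ mgf id μ₂ (-u) := mgf_nonneg
  have hpK : p ^ K ≤ 1 := pow_le_one₀ hp0 hp1
  have hq : 0 ≤ 1 - p ^ K := sub_nonneg.2 hpK
  have hε : 0 ≤ 1 - ε := sub_nonneg.2 hε1
  rw [SemiMarkovModel.phi, spectralRadius_eq_one_iff (b := p ^ K * mgf id μ₂ (-u))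
    (c := (1 - p ^ K) * mgf id μ₁ (-u) *
      (Real.exp ((R * c - u) * Tf) * (1 - ε) + Real.exp (-u * Tf) * ε)) (by positivity)
    (by positivity)]
  intro k hk
  rw [mem_spectrum_iff_det]
  have hf : mgf id (Measure.dirac Tf) (-u) = Real.exp (-(u * Tf)) := by simp [mgf]
  have ho : mgf id (Measure.dirac Tf) (R * c - u) = Real.exp ((R * c - u) * Tf) := by simp [mgf]
  have hM : (fourState K p ε Tf R μ₁ μ₂).matH c u =
      !![0, 0, ε * Real.exp (-u * Tf), (1 - ε) * Real.exp ((R * c - u) * Tf);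
        (1 - p ^ K) * mgf id μ₁ (-u), p ^ K * mgf id μ₂ (-u), 0, 0;
        (1 - p ^ K) * mgf id μ₁ (-u), p ^ K * mgf id μ₂ (-u), 0, 0;
        (1 - p ^ K) * mgf id μ₁ (-u), p ^ K * mgf id μ₂ (-u), 0, 0] := by
    ext i j
    rw [SemiMarkovModel.matH, Matrix.mul_diagonal]
    fin_cases i <;> fin_cases j <;> simp [fourState, hf, ho]
  rw [hM]
  generalize Real.exp (-u * Tf) = f at *
  generalize Real.exp ((R * c - u) * Tf) = o at *
  generalize mgf id μ₁ (-u) = m₁ at *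
  generalize mgf id μ₂ (-u) = m₂ at *
  generalize p ^ K = q at *
  have hdet : (algebraMap ℂ (Matrix (Fin 4) (Fin 4) ℂ) k -
      (!![0, 0, ε * f, (1 - ε) * o; (1 - q) * m₁, q * m₂, 0, 0; (1 - q) * m₁, q * m₂, 0, 0;
        (1 - q) * m₁, q * m₂, 0, 0] : Matrix (Fin 4) (Fin 4) ℝ).map Complex.ofReal).det =
      k ^ 2 * (k ^ 2 - (((q * m₂ : ℝ) : ℂ) * k +
        (((1 - q) * m₁ * (o * (1 - ε) + f * ε) : ℝ) : ℂ))) := by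
    simp [Matrix.det_succ_row_zero, Fin.sum_univ_succ, Matrix.algebraMap_matrix_apply,
      Fin.succAbove]
    ring
  rw [hdet, mul_eq_zero, or_iff_right (pow_ne_zero 2 hk), sub_eq_zero]

/-! ### First-passage and return laws -/

/-- The sub-probability law of the time spent in the first `k` states after a visit to `s`, on the
event that these differ from `s` and that the next state is `j`. -/
noncomputable def passageLaw {ι : Type} [Fintype ι] [DecidableEq ι] (M : SemiMarkovModel ι)
    (s : ι) : ℕ → ι → Measure ℝ
  | 0, j => ENNReal.ofReal (M.trans s j) • Measure.dirac 0
  | k + 1, j => ∑ i, if i = s then 0 else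
      (passageLaw M s k i).conv (ENNReal.ofReal (M.trans i j) • M.dwell i)

/-- The law of the time between two consecutive visits to `s`. -/
noncomputable def returnLaw {ι : Type} [Fintype ι] [DecidableEq ι] (M : SemiMarkovModel ι)
    (s : ι) : Measure ℝ :=
  Measure.sum fun k => passageLaw M s k s

/-- The event that `X n = s` and that the next `k` states differ from `s`. -/
def avoidSet {ι Ω : Type*} (X : ℕ → Ω → ι) (s : ι) (n k : ℕ) : Set Ω :=
  {ω | X n ω = s ∧ ∀ i < k, X (n + 1 + i) ω ≠ s}

section Passage

variable {ι : Type} [Fintype ι] [DecidableEq ι] {Ω : Type*} [MeasurableSpace Ω]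
  {M : SemiMarkovModel ι} {P : Measure Ω} {X : ℕ → Ω → ι} {T : ℕ → Ω → ℝ}

theorem ae_nonneg_conv {μ ν : Measure ℝ} [SFinite μ] [SFinite ν] (hμ : ∀ᵐ x ∂μ, 0 ≤ x)
    (hν : ∀ᵐ x ∂ν, 0 ≤ x) : ∀ᵐ x ∂μ.conv ν, 0 ≤ x := by
  rw [Measure.conv, ae_map_iff (by fun_prop) measurableSet_Ici]
  filter_upwards [Measure.quasiMeasurePreserving_fst.ae hμ,
    Measure.quasiMeasurePreserving_snd.ae hν] with x h1 h2
  exact add_nonneg h1 h2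

/-- Nonnegativity of the supports matters because z = 0 is allowed, where the exponential law needs
nonnegative exponents. -/
theorem lintegral_rpow_conv {μ ν : Measure ℝ} [SFinite μ] [SFinite ν] (hμ : ∀ᵐ x ∂μ, 0 ≤ x)
    (hν : ∀ᵐ x ∂ν, 0 ≤ x) {z : ℝ} (hz : 0 ≤ z) :
    ∫⁻ x, ENNReal.ofReal (z ^ x) ∂μ.conv ν =
      (∫⁻ x, ENNReal.ofReal (z ^ x) ∂μ) * ∫⁻ x, ENNReal.ofReal (z ^ x) ∂ν := by
  have hm : Measurable fun x : ℝ => ENNReal.ofReal (z ^ x) :=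
    (measurable_const.pow measurable_id).ennreal_ofReal
  rw [Measure.lintegral_conv hm, ← lintegral_mul_const _ hm]
  refine lintegral_congr_ae ?_
  filter_upwards [hμ] with x hx
  rw [← lintegral_const_mul _ hm]
  refine lintegral_congr_ae ?_
  filter_upwards [hν] with y hy
  rw [← ENNReal.ofReal_mul (Real.rpow_nonneg hz _), Real.rpow_add_of_nonneg hz hx hy]

omit [DecidableEq ι] in
theorem restrict_eq_sum_state (Q : Measure Ω) {Y : Ω → ι}
    (hY : ∀ j, MeasurableSet {ω | Y ω = j}) {A : Set Ω} :
    Q.restrict A = ∑ j, Q.restrict (A ∩ {ω | Y ω = j}) := by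
  ext B hB
  have := lintegral_eq_sum_state (Q.restrict A) hY (B.indicator 1)
  rw [lintegral_indicator_one hB] at this
  rw [this, Measure.finsetSum_apply]
  refine Finset.sum_congr rfl fun j _ => ?_
  rw [lintegral_indicator_one hB, Measure.restrict_restrict (hY j), Set.inter_comm]

omit [DecidableEq ι] [MeasurableSpace Ω] in
theorem measurableSet_past_avoidSet (s : ι) (n k : ℕ) :
    MeasurableSet[pastSigma X T (n + 1 + k)] (avoidSet X s n k) := by
  have : avoidSet X s n k = {ω | X n ω = s} ∩
      ⋂ i, ⋂ _ : i < k, {ω | X (n + 1 + i) ω = s}ᶜ := by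
    ext ω
    simp [avoidSet]
  rw [this]
  refine MeasurableSet.inter (measurableSet_past_state (by lia) s) ?_
  exact MeasurableSet.iInter fun i => MeasurableSet.iInter fun hi =>
    MeasurableSet.compl (measurableSet_past_state (by lia) s)

omit [DecidableEq ι] [MeasurableSpace Ω] in
theorem measurable_past_sum (n k : ℕ) :
    Measurable[pastSigma X T (n + 1 + k)] fun ω => ∑ i ∈ Finset.range k, T (n + 1 + i) ω :=
  Finset.measurable_fun_sum _ fun i hi =>
    measurable_past_dwell (by have := Finset.mem_range.1 hi; lia)

variable [∀ i, IsProbabilityMeasure (M.dwell i)]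

instance isFiniteMeasure_ofReal_smul (a : ℝ) (μ : Measure ℝ) [IsFiniteMeasure μ] :
    IsFiniteMeasure (ENNReal.ofReal a • μ) :=
  Measure.smul_finite _ ENNReal.ofReal_ne_top

instance isFiniteMeasure_passageLaw (s : ι) (k : ℕ) (j : ι) :
    IsFiniteMeasure (passageLaw M s k j) := by
  induction k generalizing j with
  | zero =>
    rw [passageLaw]
    infer_instance
  | succ k ih =>
    rw [passageLaw]
    have : ∀ i, IsFiniteMeasure (if i = s then 0 else
        (passageLaw M s k i).conv (ENNReal.ofReal (M.trans i j) • M.dwell i)) := by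
      intro i
      split_ifs <;> infer_instance
    infer_instance

theorem passageLaw_ae_nonneg (hd : ∀ i, ∀ᵐ y ∂M.dwell i, 0 ≤ y) (s : ι) (k : ℕ) (j : ι) :
    ∀ᵐ x ∂passageLaw M s k j, 0 ≤ x := by
  induction k generalizing j with
  | zero =>
    rw [passageLaw]
    exact Measure.ae_smul_measure (by simp) _
  | succ k ih =>
    rw [passageLaw, ← Measure.sum_fintype, Measure.ae_sum_iff]
    intro i
    split_ifs
    · simp
    · exact ae_nonneg_conv (ih i) (Measure.ae_smul_measure (hd i) _)

theorem lintegral_rpow_passageLaw_succ (hd : ∀ i, ∀ᵐ y ∂M.dwell i, 0 ≤ y) {z : ℝ} (hz : 0 ≤ z)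
    (s : ι) (k : ℕ) (j : ι) :
    ∫⁻ x, ENNReal.ofReal (z ^ x) ∂passageLaw M s (k + 1) j = ∑ i, if i = s then 0 else
      (∫⁻ x, ENNReal.ofReal (z ^ x) ∂passageLaw M s k i) *
        (ENNReal.ofReal (M.trans i j) * ∫⁻ x, ENNReal.ofReal (z ^ x) ∂M.dwell i) := by
  rw [passageLaw, lintegral_finsetSum_measure]
  refine Finset.sum_congr rfl fun i _ => ?_
  split_ifs
  · simp
  · rw [lintegral_rpow_conv (passageLaw_ae_nonneg hd s k i)
      (Measure.ae_smul_measure (hd i) _) hz, lintegral_smul_measure, smul_eq_mul]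

variable [IsProbabilityMeasure P]

/-- Induction on k, splitting by the last intermediate state i. The case i = s is impossible;
otherwise elapsed time and new sojourn have a product law by `map_step`, whose image under addition
is a convolution. -/
theorem IsSemiMarkov.map_passage (h : IsSemiMarkov M P X T) (s : ι) (n k : ℕ) (j : ι) :
    (P.restrict (avoidSet X s n k ∩ {ω | X (n + 1 + k) ω = j})).map
      (fun ω => ∑ i ∈ Finset.range k, T (n + 1 + i) ω) =
      P {ω | X n ω = s} • passageLaw M s k j := by
  induction k generalizing j with
  | zero =>
    have e := h.measure_step n s j Set.univ (@MeasurableSet.univ _ (pastSigma X T n)) Set.univ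
      MeasurableSet.univ
    simp only [Set.univ_inter, Set.preimage_univ, measure_univ, mul_one] at e
    simp only [Finset.range_zero, Finset.sum_empty, Measure.map_const, avoidSet, not_lt_zero,
      false_implies, implies_true, and_true, add_zero, passageLaw, Measure.restrict_apply_univ]
    rw [e, smul_smul]
  | succ k ih =>
    have hA := measurableSet_past_avoidSet (X := X) (T := T) s n k
    have hV := measurable_past_sum (X := X) (T := T) n k
    have hVm : Measurable fun ω => ∑ i ∈ Finset.range (k + 1), T (n + 1 + i) ω :=
      Finset.measurable_fun_sum _ fun i _ => h.measurable_dwell _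
    rw [restrict_eq_sum_state P (h.measurable_state (n + 1 + k)), passageLaw,
      ← Measure.mapₗ_apply_of_measurable hVm, map_sum, Finset.smul_sum]
    refine Finset.sum_congr rfl fun i _ => ?_
    rw [Measure.mapₗ_apply_of_measurable hVm]
    split_ifs with hi
    · have : avoidSet X s n (k + 1) ∩ {ω | X (n + 1 + (k + 1)) ω = j} ∩
          {ω | X (n + 1 + k) ω = i} = ∅ := by
        refine Set.eq_empty_of_forall_notMem fun ω hω => ?_
        exact hω.1.1.2 k k.lt_succ_self (Eq.trans hω.2 hi)
      rw [this]
      simp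
    · have : avoidSet X s n (k + 1) ∩ {ω | X (n + 1 + (k + 1)) ω = j} ∩
          {ω | X (n + 1 + k) ω = i} = avoidSet X s n k ∩
            ({ω | X (n + 1 + k) ω = i} ∩ {ω | X (n + 1 + k + 1) ω = j}) := by
        ext ω
        simp only [avoidSet, Set.mem_inter_iff, Set.mem_ofPred_eq, Nat.forall_lt_succ_right,
          ← add_assoc]
        constructor
        · rintro ⟨⟨⟨h1, h2, h3⟩, h4⟩, h5⟩
          exact ⟨⟨h1, h2⟩, h5, h4⟩
        · rintro ⟨⟨h1, h2⟩, h5, h4⟩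
          exact ⟨⟨⟨h1, h2, h5 ▸ hi⟩, h4⟩, h5⟩
      have m := h.map_step (n + 1 + k) i j hA hV
      rw [ih i] at m
      rw [this, ← Measure.conv_smul_left, Measure.conv, ← m, Measure.map_map (by fun_prop)
        ((hV.mono (h.pastSigma_le _) le_rfl).prodMk (h.measurable_dwell _))]
      congr 1
      ext ω
      simp [Finset.sum_range_succ]

/-- If the return to `s` is certain, the elapsed time has law `returnLaw M s`, whatever the visit
to `s` considered. -/
theorem IsSemiMarkov.map_return (h : IsSemiMarkov M P X T) (s : ι) (n : ℕ)
    (hmass : returnLaw M s Set.univ = 1) {f : Ω → ℝ}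
    (hf : ∀ k, ∀ ω ∈ avoidSet X s n k ∩ {ω | X (n + 1 + k) ω = s},
      f ω = ∑ i ∈ Finset.range k, T (n + 1 + i) ω) :
    (P.restrict {ω | X n ω = s}).map f = P {ω | X n ω = s} • returnLaw M s := by
  set D : ℕ → Set Ω := fun k => avoidSet X s n k ∩ {ω | X (n + 1 + k) ω = s} with hD
  have hDm : ∀ k, MeasurableSet (D k) := fun k =>
    (h.pastSigma_le _ _ (measurableSet_past_avoidSet (X := X) (T := T) s n k)).inter
      (h.measurable_state _ s)
  have hV : ∀ k, Measurable fun ω => ∑ i ∈ Finset.range k, T (n + 1 + i) ω := fun k =>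
    Finset.measurable_fun_sum _ fun i _ => h.measurable_dwell _
  have hdis : Pairwise (Function.onFun Disjoint D) := by
    have : ∀ k l, k < l → Disjoint (D k) (D l) := fun k l hkl =>
      Set.disjoint_left.2 fun ω h1 h2 => h2.1.2 k hkl h1.2
    intro k l hkl
    rcases lt_or_gt_of_ne hkl with hlt | hlt
    · exact this k l hlt
    · exact (this l k hlt).symm
  have hPD : ∀ k, P (D k) = P {ω | X n ω = s} * passageLaw M s k s Set.univ := by
    intro k
    have := congrArg (fun m => m Set.univ) (h.map_passage s n k s)
    simpa [Measure.map_apply (hV k) MeasurableSet.univ] using this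
  have hsub : ⋃ k, D k ⊆ {ω | X n ω = s} := Set.iUnion_subset fun k ω hω => hω.1.1
  -- The return events are disjoint parts of {X n = s} whose probabilities add up to P(X n = s),
  -- because the return law has mass one.
  have hae : (⋃ k, D k : Set Ω) =ᵐ[P] {ω | X n ω = s} := by
    refine ae_eq_of_subset_of_measure_ge hsub ?_ (MeasurableSet.iUnion hDm).nullMeasurableSet
      (measure_ne_top _ _)
    rw [measure_iUnion hdis hDm]
    simp_rw [hPD]
    rw [ENNReal.tsum_mul_left, ← Measure.sum_apply _ MeasurableSet.univ]
    rw [returnLaw] at hmass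
    rw [hmass, mul_one]
  have hfae : ∀ k, f =ᵐ[P.restrict (D k)] fun ω => ∑ i ∈ Finset.range k, T (n + 1 + i) ω := by
    intro k
    filter_upwards [ae_restrict_mem (hDm k)] with ω hω using hf k ω hω
  rw [← Measure.restrict_congr_set hae, Measure.restrict_iUnion hdis hDm, Measure.map_sum, returnLaw]
  · ext B hB
    rw [Measure.smul_apply, Measure.sum_apply _ hB, Measure.sum_apply _ hB, smul_eq_mul,
      ← ENNReal.tsum_mul_left]
    refine tsum_congr fun k => ?_
    rw [Measure.map_congr (hfae k), h.map_passage s n k s, Measure.smul_apply, smul_eq_mul]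
  · rw [aemeasurable_sum_measure_iff]
    exact fun k => ⟨_, hV k, hfae k⟩

end Passage

/-! ### Series and generating functions -/

/-- A two-term recursion with nonnegative coefficients sums like a geometric series. -/
theorem tsum_two_term_recursion {Q : ℕ → ENNReal} {a b : ENNReal} (h0 : Q 0 = 1) (h1 : Q 1 = a)
    (h2 : ∀ k, Q (k + 2) = a * Q (k + 1) + b * Q k) : ∑' k, Q k = (1 - (a + b))⁻¹ := by
  have hfull : ∑' k, Q k = 1 + (a + b) * ∑' k, Q k := by
    have e1 : ∑' k, Q k = 1 + ∑' k, Q (k + 1) := by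
      rw [tsum_eq_zero_add' ENNReal.summable, h0]
    have e2 : ∑' k, Q (k + 1) = a + (a * ∑' k, Q (k + 1) + b * ∑' k, Q k) := by
      rw [← ENNReal.tsum_mul_left, ← ENNReal.tsum_mul_left, ← ENNReal.tsum_add, ← tsum_congr h2,
        tsum_eq_zero_add' (f := fun k => Q (k + 1)) ENNReal.summable, h1]
    calc ∑' k, Q k = 1 + (a + (a * ∑' k, Q (k + 1) + b * ∑' k, Q k)) := by rw [← e2, ← e1]
      _ = 1 + (a * (1 + ∑' k, Q (k + 1)) + b * ∑' k, Q k) := by ring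
      _ = _ := by rw [← e1]; ring
  -- The fixed-point equation alone does not determine the sum, which may be ⊤. So it is compared
  -- with the geometric series both ways: partial sums by the recursion, and the converse by
  -- iterating `hfull`.
  rw [← ENNReal.tsum_geometric]
  refine le_antisymm (ENNReal.tsum_le_of_sum_range_le fun N => ?_)
    (ENNReal.tsum_le_of_sum_range_le fun N => ?_)
  · refine le_trans ?_ (ENNReal.sum_le_tsum (Finset.range N))
    have step : ∀ N, ∑ k ∈ Finset.range (N + 2), Q k =
        1 + (a * ∑ k ∈ Finset.range (N + 1), Q k + b * ∑ k ∈ Finset.range N, Q k) := by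
      intro N
      induction N with
      | zero => simp [Finset.sum_range_succ, h0, h1]
      | succ N ih =>
        calc ∑ k ∈ Finset.range (N + 1 + 2), Q k
            = 1 + (a * ∑ k ∈ Finset.range (N + 1), Q k + b * ∑ k ∈ Finset.range N, Q k) +
              (a * Q (N + 1) + b * Q N) := by rw [← ih, ← h2, ← Finset.sum_range_succ]
          _ = 1 + (a * (∑ k ∈ Finset.range (N + 1), Q k + Q (N + 1)) +
              b * (∑ k ∈ Finset.range N, Q k + Q N)) := by ring
          _ = _ := by rw [← Finset.sum_range_succ, ← Finset.sum_range_succ]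
    induction N with
    | zero => simp
    | succ N ih =>
      rw [Finset.sum_range_succ' (fun k => (a + b) ^ k) N]
      simp_rw [pow_succ']
      rw [← Finset.mul_sum, pow_zero, add_comm _ (1 : ENNReal)]
      cases N with
      | zero => simp [h0]
      | succ N =>
        rw [step N]
        gcongr
        calc a * ∑ k ∈ Finset.range (N + 1), Q k + b * ∑ k ∈ Finset.range N, Q k
            ≤ a * ∑ k ∈ Finset.range (N + 1), Q k + b * ∑ k ∈ Finset.range (N + 1), Q k := by
              gcongr
              lia
          _ = (a + b) * ∑ k ∈ Finset.range (N + 1), Q k := by ring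
          _ ≤ _ := by gcongr
  · induction N with
    | zero => simp
    | succ N ih =>
      rw [Finset.sum_range_succ' _ N, hfull]
      simp_rw [pow_succ']
      rw [← Finset.mul_sum, pow_zero, add_comm _ (1 : ENNReal)]
      gcongr

section GeneratingFunction

variable {μ : Measure ℝ} {z : ℝ}

theorem measurable_const_rpow (z : ℝ) : Measurable fun x : ℝ => z ^ x :=
  measurable_const.pow measurable_id

theorem integrable_rpow_iff (hz : 0 ≤ z) :
    Integrable (fun x : ℝ => z ^ x) μ ↔ ∫⁻ x, ENNReal.ofReal (z ^ x) ∂μ ≠ ⊤ := by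
  rw [lintegral_ofReal_ne_top_iff_integrable (measurable_const_rpow z).aestronglyMeasurable
    (ae_of_all _ fun x => Real.rpow_nonneg hz x)]

theorem pgf_eq_toReal (hz : 0 ≤ z) :
    pgf μ z = (∫⁻ x, ENNReal.ofReal (z ^ x) ∂μ).toReal :=
  integral_eq_lintegral_of_nonneg_ae (ae_of_all _ fun x => Real.rpow_nonneg hz x)
    (measurable_const_rpow z).aestronglyMeasurable

theorem lintegral_rpow_eq (hz : 0 ≤ z) (h : Integrable (fun x : ℝ => z ^ x) μ) :
    ∫⁻ x, ENNReal.ofReal (z ^ x) ∂μ = ENNReal.ofReal (pgf μ z) := by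
  rw [pgf_eq_toReal hz, ENNReal.ofReal_toReal ((integrable_rpow_iff hz).1 h)]

theorem pgf_nonneg (hz : 0 ≤ z) : 0 ≤ pgf μ z :=
  integral_nonneg fun x => Real.rpow_nonneg hz x

theorem integrable_rpow_of_le_one [IsFiniteMeasure μ] (hμ : ∀ᵐ x ∂μ, 0 ≤ x) (hz : 0 ≤ z)
    (hz1 : z ≤ 1) : Integrable (fun x : ℝ => z ^ x) μ := by
  refine (integrable_const (1 : ℝ)).mono' (measurable_const_rpow z).aestronglyMeasurable ?_
  filter_upwards [hμ] with x hx
  rw [Real.norm_of_nonneg (Real.rpow_nonneg hz x)]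
  exact Real.rpow_le_one hz hz1 hx

theorem integrable_rpow_of_one_lt [IsFiniteMeasure μ] (hμ : ∀ᵐ x ∂μ, 0 ≤ x)
    (h : ∀ z : ℝ, 1 < z → Integrable (fun x : ℝ => z ^ x) μ) (hz : 0 ≤ z) :
    Integrable (fun x : ℝ => z ^ x) μ :=
  (le_or_gt z 1).elim (integrable_rpow_of_le_one hμ hz) (h z)

theorem pgf_le_one [IsProbabilityMeasure μ] (hμ : ∀ᵐ x ∂μ, 0 ≤ x) (hz : 0 ≤ z)
    (hz1 : z ≤ 1) : pgf μ z ≤ 1 := by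
  have : pgf μ z ≤ ∫ _, (1 : ℝ) ∂μ := by
    refine integral_mono_ae (integrable_rpow_of_le_one hμ hz hz1) (integrable_const _) ?_
    filter_upwards [hμ] with x hx using Real.rpow_le_one hz hz1 hx
  simpa using this

theorem exp_rpow (t x : ℝ) : Real.exp t ^ x = Real.exp (t * x) := (Real.exp_mul t x).symm

theorem pgf_exp (t : ℝ) : pgf μ (Real.exp t) = mgf id μ t := by
  simp only [pgf, mgf, exp_rpow, id]

theorem lintegral_exp_eq {t : ℝ} (h : Integrable (fun x : ℝ => Real.exp t ^ x) μ) :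
    ∫⁻ x, ENNReal.ofReal (Real.exp (t * x)) ∂μ = ENNReal.ofReal (pgf μ (Real.exp t)) := by
  rw [← lintegral_rpow_eq (Real.exp_pos t).le h]
  simp only [exp_rpow]

theorem pgf_exp_pos [IsProbabilityMeasure μ] {t : ℝ}
    (h : Integrable (fun x : ℝ => Real.exp t ^ x) μ) : 0 < pgf μ (Real.exp t) := by
  rw [pgf_exp]
  refine mgf_pos ?_
  simpa only [exp_rpow, id] using h

theorem pgf_mono {z' : ℝ} (hμ : ∀ᵐ x ∂μ, 0 ≤ x) (hz : 0 ≤ z) (hzz : z ≤ z')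
    (h : Integrable (fun x : ℝ => z ^ x) μ) (h' : Integrable (fun x : ℝ => z' ^ x) μ) :
    pgf μ z ≤ pgf μ z' := by
  refine integral_mono_ae h h' ?_
  filter_upwards [hμ] with x hx using Real.rpow_le_rpow hz hzz hx

theorem continuous_pgf_exp (h : ∀ t : ℝ, Integrable (fun x : ℝ => Real.exp t ^ x) μ) :
    Continuous fun t : ℝ => pgf μ (Real.exp t) := by
  simp only [pgf_exp]
  refine continuous_mgf fun t => ?_
  simpa only [exp_rpow, id_eq] using h t

/-- Monotone convergence. The limit may be ⊤, as happens for the OFF duration outside its domain of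
convergence. -/
theorem tendsto_lintegral_indicator_Iic {f : ℝ → ENNReal} (hf : Measurable f) :
    Tendsto (fun n : ℕ => ∫⁻ x, (Set.Iic (n : ℝ)).indicator f x ∂μ) atTop
      (𝓝 (∫⁻ x, f x ∂μ)) := by
  refine lintegral_tendsto_of_tendsto_of_monotone
    (fun n => (hf.indicator measurableSet_Iic).aemeasurable) (ae_of_all _ fun x => ?_)
    (ae_of_all _ fun x => ?_)
  · intro m n hmn
    refine Set.indicator_le_indicator_of_subset ?_ (fun _ => zero_le) x
    exact Set.Iic_subset_Iic.2 (by exact_mod_cast hmn)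
  · refine tendsto_const_nhds.congr' ?_
    obtain ⟨N, hN⟩ := exists_nat_ge x
    filter_upwards [eventually_ge_atTop N] with n hn
    have : x ≤ n := hN.trans (by exact_mod_cast hn)
    simp [this]

end GeneratingFunction

theorem offDuration_eq {Ω : Type*} {X : ℕ → Ω → Fin 4} {T : ℕ → Ω → ℝ} {n k : ℕ} {ω : Ω}
    (hω : ω ∈ avoidSet X 3 n k ∩ {ω | X (n + 1 + k) ω = 3}) :
    offDuration X T n ω = ∑ i ∈ Finset.range k, T (n + 1 + i) ω := by
  rw [offDuration, tsum_eq_sum (s := Finset.range k)]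
  · refine Finset.sum_congr rfl fun j hj => Set.indicator_of_mem ?_ _
    exact fun i hi => hω.1.2 i (hi.trans_lt (Finset.mem_range.1 hj))
  · intro j hj
    refine Set.indicator_of_notMem ?_ _
    exact fun h => h k (by simpa using hj) hω.2

/-! ### The transform of the return time to ON -/

section FourState

variable {K : ℕ} {p ε Tf R : ℝ} {μ₁ μ₂ : Measure ℝ}

instance isProbabilityMeasure_fourState_dwell [IsProbabilityMeasure μ₁] [IsProbabilityMeasure μ₂]
    (i : Fin 4) : IsProbabilityMeasure ((fourState K p ε Tf R μ₁ μ₂).dwell i) := by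
  fin_cases i <;> simp only [fourState] <;> dsimp <;> infer_instance

theorem fourState_dwell_nonneg (hTf : 0 ≤ Tf) (hμ₁ : ∀ᵐ x ∂μ₁, 0 ≤ x) (hμ₂ : ∀ᵐ x ∂μ₂, 0 ≤ x)
    (i : Fin 4) : ∀ᵐ y ∂(fourState K p ε Tf R μ₁ μ₂).dwell i, 0 ≤ y := by
  fin_cases i
  · exact hμ₁
  · exact hμ₂
  · simpa [fourState] using hTf
  · simpa [fourState] using hTf

theorem lintegral_rpow_returnLaw_fourState [IsProbabilityMeasure μ₁] [IsProbabilityMeasure μ₂]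
    (hTf : 0 ≤ Tf) (hμ₁ : ∀ᵐ x ∂μ₁, 0 ≤ x) (hμ₂ : ∀ᵐ x ∂μ₂, 0 ≤ x) {z : ℝ} (hz : 0 ≤ z) :
    ∫⁻ x, ENNReal.ofReal (z ^ x) ∂returnLaw (fourState K p ε Tf R μ₁ μ₂) 3 =
      ENNReal.ofReal (1 - ε) * ENNReal.ofReal (1 - p ^ K) *
        (∫⁻ x, ENNReal.ofReal (z ^ x) ∂μ₁) *
        (1 - (ENNReal.ofReal (p ^ K) * ∫⁻ x, ENNReal.ofReal (z ^ x) ∂μ₂ +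
          ENNReal.ofReal ε * ENNReal.ofReal (1 - p ^ K) *
            (∫⁻ x, ENNReal.ofReal (z ^ x) ∂μ₁) * ENNReal.ofReal (z ^ Tf)))⁻¹ := by
  set M := fourState K p ε Tf R μ₁ μ₂ with hM
  set m₁ := ∫⁻ x, ENNReal.ofReal (z ^ x) ∂μ₁ with hm₁
  set m₂ := ∫⁻ x, ENNReal.ofReal (z ^ x) ∂μ₂ with hm₂
  set G : ℕ → Fin 4 → ENNReal := fun k j => ∫⁻ x, ENNReal.ofReal (z ^ x) ∂passageLaw M 3 k j
    with hG
  have hd := fourState_dwell_nonneg (K := K) (p := p) (ε := ε) (R := R) hTf hμ₁ hμ₂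
  have G0 : ∀ j, G 0 j = ENNReal.ofReal (M.trans 3 j) := by
    intro j
    simp [hG, passageLaw]
  have hsucc : ∀ k j, G (k + 1) j = G k 0 * (ENNReal.ofReal (M.trans 0 j) * m₁) +
      G k 1 * (ENNReal.ofReal (M.trans 1 j) * m₂) +
      G k 2 * (ENNReal.ofReal (M.trans 2 j) * ENNReal.ofReal (z ^ Tf)) := by
    intro k j
    simp only [hG]
    rw [lintegral_rpow_passageLaw_succ hd hz, Fin.sum_univ_four]
    simp [hM, fourState, hm₁, hm₂]
  -- `Q k` is the transform mass that, after k intermediate sojourns, is leaving ON, OFF₁ or OFF₃,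
  -- the states sharing the row (1 - p^K, p^K, 0, 0). A further loop is one OFF₃ sojourn (factor a)
  -- or OFF₂ followed by OFF₁ (factor b).
  set Q : ℕ → ENNReal := fun k => Nat.casesOn k 1 fun k => G k 1 * m₂ + G k 2 * ENNReal.ofReal (z ^ Tf)
    with hQ
  have g0 : ∀ k, G k 0 = ENNReal.ofReal (1 - p ^ K) * Q k := by
    intro k
    cases k with
    | zero => simp [G0, hQ, hM, fourState]
    | succ k =>
      rw [hsucc]
      simp [hQ, hM, fourState]
      ring
  have g1 : ∀ k, G k 1 = ENNReal.ofReal (p ^ K) * Q k := by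
    intro k
    cases k with
    | zero => simp [G0, hQ, hM, fourState]
    | succ k =>
      rw [hsucc]
      simp [hQ, hM, fourState]
      ring
  have g2 : ∀ k, G (k + 1) 2 = ENNReal.ofReal ε * m₁ * G k 0 := by
    intro k
    rw [hsucc]
    simp [hM, fourState]
    ring
  have g3 : ∀ k, G (k + 1) 3 = ENNReal.ofReal (1 - ε) * m₁ * G k 0 := by
    intro k
    rw [hsucc]
    simp [hM, fourState]
    ring
  have hQsum := tsum_two_term_recursion (Q := Q) (a := ENNReal.ofReal (p ^ K) * m₂)
    (b := ENNReal.ofReal ε * ENNReal.ofReal (1 - p ^ K) * m₁ * ENNReal.ofReal (z ^ Tf)) rfl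
    (by simp [hQ, G0, hM, fourState]) (fun k => by
      have : Q (k + 2) = G (k + 1) 1 * m₂ + G (k + 1) 2 * ENNReal.ofReal (z ^ Tf) := rfl
      rw [this, g1, g2, g0]
      ring)
  rw [returnLaw, lintegral_sum_measure]
  change ∑' k, G k 3 = _
  -- The term k = 0 vanishes, since ON never follows ON directly.
  rw [tsum_eq_zero_add' ENNReal.summable, ← hQsum]
  simp_rw [g3, g0]
  rw [ENNReal.tsum_mul_left, ENNReal.tsum_mul_left]
  simp [G0, hM, fourState]
  ring

theorem stepGain_fourState {ψ : Fin 4 → ℝ → ENNReal} {g : Fin 4 → ℝ} {v : Fin 4 → ℝ}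
    (hp0 : 0 ≤ p) (hp1 : p ≤ 1) (hε0 : 0 ≤ ε) (hε1 : ε ≤ 1) (hv : ∀ i, 0 ≤ v i)
    (hg0 : ∀ i, 0 ≤ g i)
    (hg : ∀ i, ∫⁻ y, ψ i y ∂(fourState K p ε Tf R μ₁ μ₂).dwell i = ENNReal.ofReal (g i))
    (i : Fin 4) :
    stepGain (fourState K p ε Tf R μ₁ μ₂) ψ (fun j => ENNReal.ofReal (v j)) i =
      ENNReal.ofReal (g i * if i = 0 then ε * v 2 + (1 - ε) * v 3
        else (1 - p ^ K) * v 0 + p ^ K * v 1) := by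
  have hq : 0 ≤ 1 - p ^ K := sub_nonneg.2 (pow_le_one₀ hp0 hp1)
  have hq' : 0 ≤ p ^ K := pow_nonneg hp0 K
  have hε : 0 ≤ 1 - ε := sub_nonneg.2 hε1
  have e1 : ENNReal.ofReal (ε * v 2 + (1 - ε) * v 3) = ENNReal.ofReal ε * ENNReal.ofReal (v 2) +
      ENNReal.ofReal (1 - ε) * ENNReal.ofReal (v 3) := by
    rw [ENNReal.ofReal_add (mul_nonneg hε0 (hv 2)) (mul_nonneg hε (hv 3)),
      ENNReal.ofReal_mul hε0, ENNReal.ofReal_mul hε]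
  have e2 : ENNReal.ofReal ((1 - p ^ K) * v 0 + p ^ K * v 1) =
      ENNReal.ofReal (1 - p ^ K) * ENNReal.ofReal (v 0) +
      ENNReal.ofReal (p ^ K) * ENNReal.ofReal (v 1) := by
    rw [ENNReal.ofReal_add (mul_nonneg hq (hv 0)) (mul_nonneg hq' (hv 1)),
      ENNReal.ofReal_mul hq, ENNReal.ofReal_mul hq']
  rw [stepGain, hg, ENNReal.ofReal_mul (hg0 i), Fin.sum_univ_four]
  congr 1
  split_ifs with hi
  · subst hi
    rw [e1]
    simp [fourState]
  · rw [e2]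
    fin_cases i
    · exact absurd rfl hi
    all_goals simp [fourState]

end FourState

section TwoState

variable {Tf R : ℝ} {μ₃ : Measure ℝ}

instance isProbabilityMeasure_twoState_dwell [IsProbabilityMeasure μ₃] (i : Fin 2) :
    IsProbabilityMeasure ((twoState Tf R μ₃).dwell i) := by
  fin_cases i <;> simp only [twoState] <;> dsimp <;> infer_instance

theorem twoState_dwell_nonneg (hTf : 0 ≤ Tf) (hμ₃ : ∀ᵐ x ∂μ₃, 0 ≤ x)
    (i : Fin 2) : ∀ᵐ y ∂(twoState Tf R μ₃).dwell i, 0 ≤ y := by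
  fin_cases i
  · exact hμ₃
  · simpa [twoState] using hTf

theorem stepGain_twoState_off (ψ : Fin 2 → ℝ → ENNReal) (v : Fin 2 → ENNReal) :
    stepGain (twoState Tf R μ₃) ψ v 0 = (∫⁻ y, ψ 0 y ∂μ₃) * v 1 := by
  simp [stepGain, twoState]

theorem stepGain_twoState_on (ψ : Fin 2 → ℝ → ENNReal) (v : Fin 2 → ENNReal) :
    stepGain (twoState Tf R μ₃) ψ v 1 = ψ 1 Tf * v 0 := by
  simp [stepGain, twoState]

end TwoState

/-! ### The root, and the capacity of the four-state model -/

/-- The left-hand side of the characteristic equation of the four-state model. -/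
noncomputable def fourStateFun (K : ℕ) (p ε Tf R : ℝ) (μ₁ μ₂ : Measure ℝ) (θ C : ℝ) : ℝ :=
  (1 - p ^ K) * pgf μ₁ (Real.exp (θ * C)) *
      (Real.exp ((-R * θ + θ * C) * Tf) * (1 - ε) + Real.exp (θ * C * Tf) * ε)
    + p ^ K * pgf μ₂ (Real.exp (θ * C))

section FourState

variable {K : ℕ} {p ε Tf R : ℝ} {μ₁ μ₂ : Measure ℝ} [IsProbabilityMeasure μ₁]
  [IsProbabilityMeasure μ₂] {θ : ℝ}

omit [IsProbabilityMeasure μ₂] in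
-- The ON factor is strictly increasing in C and has a positive coefficient, as p^K < 1, ε < 1 and
-- the transform of t₁ is positive. The rest is nondecreasing.
theorem strictMono_fourStateFun (hp0 : 0 ≤ p) (hq : p ^ K < 1) (hε0 : 0 ≤ ε) (hε1 : ε < 1)
    (hTf : 0 < Tf) (hμ₁ : ∀ᵐ x ∂μ₁, 0 ≤ x) (hμ₂ : ∀ᵐ x ∂μ₂, 0 ≤ x)
    (h₁ : ∀ t : ℝ, Integrable (fun x : ℝ => Real.exp t ^ x) μ₁)
    (h₂ : ∀ t : ℝ, Integrable (fun x : ℝ => Real.exp t ^ x) μ₂) (hθ : 0 < θ) :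
    StrictMono (fourStateFun K p ε Tf R μ₁ μ₂ θ) := by
  intro C C' hC
  have hlt : θ * C < θ * C' := by gcongr
  have hexp := Real.exp_le_exp.2 hlt.le
  have m₁ := pgf_mono hμ₁ (Real.exp_pos _).le hexp (h₁ _) (h₁ _)
  have m₂ := pgf_mono hμ₂ (Real.exp_pos _).le hexp (h₂ _) (h₂ _)
  have p₁ := pgf_exp_pos (h₁ (θ * C))
  have hq0 : 0 ≤ p ^ K := pow_nonneg hp0 K
  have e₁ : Real.exp ((-R * θ + θ * C) * Tf) < Real.exp ((-R * θ + θ * C') * Tf) := by gcongr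
  have e₂ : Real.exp (θ * C * Tf) ≤ Real.exp (θ * C' * Tf) := by gcongr
  have hε : 0 < 1 - ε := by linarith
  have hq1 : 0 < 1 - p ^ K := by linarith
  have b : Real.exp ((-R * θ + θ * C) * Tf) * (1 - ε) + Real.exp (θ * C * Tf) * ε <
      Real.exp ((-R * θ + θ * C') * Tf) * (1 - ε) + Real.exp (θ * C' * Tf) * ε := by
    have := mul_lt_mul_of_pos_right e₁ hε
    have := mul_le_mul_of_nonneg_right e₂ hε0
    linarith
  unfold fourStateFun
  refine add_lt_add_of_lt_of_le ?_ (by gcongr)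
  refine mul_lt_mul' (by gcongr) b (by positivity) (mul_pos hq1 (p₁.trans_le m₁))

/-- Intermediate values on [0, R]. At C = 0 all transforms are 1 and service only lowers the value;
at C = R the ON exponent vanishes and the other factors are at least 1. -/
theorem exists_fourStateFun_eq_one (hp0 : 0 ≤ p) (hq : p ^ K < 1) (hε0 : 0 ≤ ε) (hε1 : ε < 1)
    (hTf : 0 < Tf) (hR : 0 ≤ R) (hμ₁ : ∀ᵐ x ∂μ₁, 0 ≤ x) (hμ₂ : ∀ᵐ x ∂μ₂, 0 ≤ x)
    (h₁ : ∀ t : ℝ, Integrable (fun x : ℝ => Real.exp t ^ x) μ₁)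
    (h₂ : ∀ t : ℝ, Integrable (fun x : ℝ => Real.exp t ^ x) μ₂) (hθ : 0 < θ) :
    ∃ C, 0 ≤ C ∧ fourStateFun K p ε Tf R μ₁ μ₂ θ C = 1 := by
  have hq0 : 0 ≤ p ^ K := pow_nonneg hp0 K
  have hε : 0 ≤ 1 - ε := by linarith
  have hq1 : 0 ≤ 1 - p ^ K := by linarith
  have one : ∀ μ : Measure ℝ, IsProbabilityMeasure μ → pgf μ 1 = 1 := by
    intro μ _
    simp [pgf]
  have o₁ := one μ₁ inferInstance
  have o₂ := one μ₂ inferInstance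
  have hcont : Continuous (fourStateFun K p ε Tf R μ₁ μ₂ θ) := by
    have c₁ : Continuous fun C => pgf μ₁ (Real.exp (θ * C)) :=
      (continuous_pgf_exp h₁).comp (continuous_const.mul continuous_id)
    have c₂ : Continuous fun C => pgf μ₂ (Real.exp (θ * C)) :=
      (continuous_pgf_exp h₂).comp (continuous_const.mul continuous_id)
    unfold fourStateFun
    fun_prop
  have hlo : fourStateFun K p ε Tf R μ₁ μ₂ θ 0 ≤ 1 := by
    have : Real.exp (-R * θ * Tf) ≤ 1 := by
      refine Real.exp_le_one_iff.2 ?_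
      have : 0 ≤ R * θ * Tf := by positivity
      linarith
    have h2 : (1 - p ^ K) * (Real.exp (-R * θ * Tf) * (1 - ε) + ε) ≤
        (1 - p ^ K) * (1 * (1 - ε) + ε) := by gcongr
    simp only [fourStateFun, mul_zero, Real.exp_zero, o₁, o₂, add_zero, zero_mul, mul_one,
      one_mul] at h2 ⊢
    linarith
  have hhi : 1 ≤ fourStateFun K p ε Tf R μ₁ μ₂ θ R := by
    have hexp : (1 : ℝ) ≤ Real.exp (θ * R) := Real.one_le_exp (by positivity)
    have i₁ : Integrable (fun x : ℝ => (1 : ℝ) ^ x) μ₁ := by simp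
    have i₂ : Integrable (fun x : ℝ => (1 : ℝ) ^ x) μ₂ := by simp
    have m₁ := pgf_mono hμ₁ zero_le_one hexp i₁ (h₁ _)
    have m₂ := pgf_mono hμ₂ zero_le_one hexp i₂ (h₂ _)
    rw [o₁] at m₁
    rw [o₂] at m₂
    have e₁ : (1 : ℝ) ≤ Real.exp (θ * R * Tf) := Real.one_le_exp (by positivity)
    have e₂ : Real.exp ((-R * θ + θ * R) * Tf) = 1 := by
      rw [show (-R * θ + θ * R) * Tf = 0 by ring, Real.exp_zero]
    unfold fourStateFun
    rw [e₂]
    calc (1 : ℝ) = (1 - p ^ K) * 1 * (1 * (1 - ε) + 1 * ε) + p ^ K * 1 := by ring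
      _ ≤ _ := by gcongr
  obtain ⟨C, hC, hC1⟩ := intermediate_value_Icc hR hcont.continuousOn ⟨hlo, hhi⟩
  exact ⟨C, hC.1, hC1⟩

theorem fourState_isEffectiveCapacity {Ω : Type*} [MeasurableSpace Ω] {P : Measure Ω}
    [IsProbabilityMeasure P] {X : ℕ → Ω → Fin 4} {T : ℕ → Ω → ℝ}
    (hXT : IsSemiMarkov (fourState K p ε Tf R μ₁ μ₂) P X T)
    (hp0 : 0 ≤ p) (hp1 : p < 1) (hq : p ^ K < 1) (hε0 : 0 ≤ ε) (hε1 : ε < 1)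
    (hTf : 0 < Tf) (hR : 0 ≤ R) (hμ₁ : ∀ᵐ x ∂μ₁, 0 ≤ x) (hμ₂ : ∀ᵐ x ∂μ₂, 0 ≤ x)
    (h₁ : ∀ t : ℝ, Integrable (fun x : ℝ => Real.exp t ^ x) μ₁)
    (h₂ : ∀ t : ℝ, Integrable (fun x : ℝ => Real.exp t ^ x) μ₂) (hθ : 0 < θ) {C : ℝ}
    (hC0 : 0 ≤ C) (hC : fourStateFun K p ε Tf R μ₁ μ₂ θ C = 1) :
    IsEffectiveCapacity P (service (fourState K p ε Tf R μ₁ μ₂) X T) θ C := by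
  have hq0 : 0 ≤ p ^ K := pow_nonneg hp0 K
  have hε : 0 < 1 - ε := by linarith
  have hq1 : 0 < 1 - p ^ K := by linarith
  refine hXT.isEffectiveCapacity (B := R * Tf) hθ hC0 ?_
    (fourState_dwell_nonneg hTf.le hμ₁ hμ₂) ?_ ?_ ?_ ?_
  · intro i
    fin_cases i <;> simp [fourState, hR]
  · have hB : 0 ≤ R * Tf := by positivity
    intro i
    fin_cases i <;> simp [fourState, hB]
  · have hf0 := Real.exp_pos (-Tf)
    have hf1 : Real.exp (-Tf) < 1 := Real.exp_lt_one_iff.2 (by linarith)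
    have hexp : Real.exp (-1) ≤ 1 := Real.exp_le_one_iff.2 (by norm_num)
    have k₁ := pgf_le_one hμ₁ (Real.exp_pos (-1)).le hexp
    have k₂ := pgf_le_one hμ₂ (Real.exp_pos (-1)).le hexp
    have n₁ : 0 ≤ pgf μ₁ (Real.exp (-1)) := pgf_nonneg (Real.exp_pos (-1)).le
    have n₂ : 0 ≤ pgf μ₂ (Real.exp (-1)) := pgf_nonneg (Real.exp_pos (-1)).le
    have hg : ∀ i, ∫⁻ y, ENNReal.ofReal (Real.exp (-y)) ∂(fourState K p ε Tf R μ₁ μ₂).dwell i =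
        ENNReal.ofReal (![pgf μ₁ (Real.exp (-1)), pgf μ₂ (Real.exp (-1)), Real.exp (-Tf),
          Real.exp (-Tf)] i) := by
      intro i
      fin_cases i
      · simpa [fourState] using lintegral_exp_eq (h₁ (-1))
      · simpa [fourState] using lintegral_exp_eq (h₂ (-1))
      · simp [fourState]
      · simp [fourState]
    generalize Real.exp (-Tf) = f at *
    generalize pgf μ₁ (Real.exp (-1)) = m₁ at *
    generalize pgf μ₂ (Real.exp (-1)) = m₂ at *
    -- t₁ and t₂ may vanish, so only the sojourns of length Tf discount. Taking f < β < 1, the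
    -- potential (β, 1, f, f) contracts by f/β in OFF₂, and by (1 - p^K)β + p^K in the other states.
    obtain ⟨β, hβf, hβ1⟩ := exists_between hf1
    have hβ0 : 0 < β := hf0.trans hβf
    have hr1 : (1 - p ^ K) * β + p ^ K < 1 := by nlinarith
    have hv : ∀ i, 0 < (![β, 1, f, f] : Fin 4 → ℝ) i := by
      intro i
      fin_cases i <;> simp [hf0, hβ0]
    refine ⟨![β, 1, f, f], hv, max (f / β) ((1 - p ^ K) * β + p ^ K), by positivity,
      max_lt ((div_lt_one hβ0).2 hβf) hr1, fun i => ?_⟩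
    rw [stepGain_fourState hp0 hp1.le hε0 hε1.le (fun i => (hv i).le) ?_ hg]
    · refine ENNReal.ofReal_le_ofReal ?_
      have a₁ := le_max_left (f / β) ((1 - p ^ K) * β + p ^ K)
      have a₂ := le_max_right (f / β) ((1 - p ^ K) * β + p ^ K)
      generalize max (f / β) ((1 - p ^ K) * β + p ^ K) = r at *
      rw [div_le_iff₀ hβ0] at a₁
      have hs : 0 ≤ (1 - p ^ K) * β + p ^ K := by positivity
      fin_cases i
      · simp
        nlinarith
      · simp
        nlinarith
      · simp
        nlinarith
      · simp
        nlinarith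
    · intro i
      fin_cases i <;> simp [n₁, n₂, hf0.le]
  · have p₁ := pgf_exp_pos (h₁ (θ * C))
    have p₂ := pgf_exp_pos (h₂ (θ * C))
    have hg : ∀ i, ∫⁻ y, ENNReal.ofReal (Real.exp (θ * C * y -
          θ * ((fourState K p ε Tf R μ₁ μ₂).rate i * y))) ∂(fourState K p ε Tf R μ₁ μ₂).dwell i =
        ENNReal.ofReal (![pgf μ₁ (Real.exp (θ * C)), pgf μ₂ (Real.exp (θ * C)),
          Real.exp (θ * C * Tf), Real.exp ((-R * θ + θ * C) * Tf)] i) := by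
      intro i
      fin_cases i
      · simpa [fourState] using lintegral_exp_eq (h₁ (θ * C))
      · simpa [fourState] using lintegral_exp_eq (h₂ (θ * C))
      · simp [fourState]
      · simp [fourState]
        ring_nf
    rw [fourStateFun] at hC
    have pf := Real.exp_pos (θ * C * Tf)
    have po := Real.exp_pos ((-R * θ + θ * C) * Tf)
    generalize Real.exp (θ * C * Tf) = f at *
    generalize Real.exp ((-R * θ + θ * C) * Tf) = o at *
    generalize pgf μ₁ (Real.exp (θ * C)) = m₁ at *
    generalize pgf μ₂ (Real.exp (θ * C)) = m₂ at *
    -- The fixed vector of ΓP, normalised so that (1 - p^K)v₀ + p^K v₁ = 1; this normalisation is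
    -- the characteristic equation.
    have hv : ∀ i, 0 < (![m₁ * (ε * f + (1 - ε) * o), m₂, f, o] : Fin 4 → ℝ) i := by
      intro i
      fin_cases i
      · have : 0 < m₁ * (ε * f + (1 - ε) * o) := by positivity
        simpa using this
      · exact p₂
      · exact pf
      · exact po
    have hw : (1 - p ^ K) * (m₁ * (ε * f + (1 - ε) * o)) + p ^ K * m₂ = 1 := by
      linear_combination hC
    refine ⟨_, hv, fun i => ?_⟩
    rw [stepGain_fourState hp0 hp1.le hε0 hε1.le (fun i => (hv i).le) ?_ hg]
    · refine ENNReal.ofReal_le_ofReal ?_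
      fin_cases i <;> simp [hw]
    · intro i
      fin_cases i <;> simp [p₁.le, p₂.le, pf.le, po.le]
  · intro C' hC'
    have hF : 1 < fourStateFun K p ε Tf R μ₁ μ₂ θ C' := by
      rw [← hC]
      exact strictMono_fourStateFun hp0 hq hε0 hε1 hTf hμ₁ hμ₂ h₁ h₂ hθ hC'
    have p₁ := pgf_exp_pos (h₁ (θ * C'))
    have p₂ := pgf_exp_pos (h₂ (θ * C'))
    have pf := Real.exp_pos (θ * C' * Tf)
    have po := Real.exp_pos ((-R * θ + θ * C') * Tf)
    have hmeas : Measurable fun y : ℝ => ENNReal.ofReal (Real.exp (θ * C' * y)) := by fun_prop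
    set L : Measure ℝ → ℕ → ENNReal := fun μ n => ∫⁻ y, (Set.Iic (n : ℝ)).indicator
      (fun y => ENNReal.ofReal (Real.exp (θ * C' * y))) y ∂μ with hL
    have tl : ∀ μ : Measure ℝ, Integrable (fun x : ℝ => Real.exp (θ * C') ^ x) μ →
        (∀ n, L μ n ≠ ⊤) ∧
        Tendsto (fun n => (L μ n).toReal) atTop (𝓝 (pgf μ (Real.exp (θ * C')))) := by
      intro μ h
      have e := lintegral_exp_eq h
      constructor
      · intro n
        refine ((lintegral_mono fun y => Set.indicator_le_self _ _ y).trans_lt ?_).ne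
        rw [e]
        exact ENNReal.ofReal_lt_top
      · have := tendsto_lintegral_indicator_Iic (μ := μ) hmeas
        rw [e] at this
        have h2 := (ENNReal.tendsto_toReal ENNReal.ofReal_ne_top).comp this
        rwa [ENNReal.toReal_ofReal (pgf_nonneg (Real.exp_pos _).le)] at h2
    obtain ⟨f₁, t₁⟩ := tl μ₁ (h₁ _)
    obtain ⟨f₂, t₂⟩ := tl μ₂ (h₂ _)
    have tF : Tendsto (fun n => (1 - p ^ K) * (L μ₁ n).toReal *
        (Real.exp ((-R * θ + θ * C') * Tf) * (1 - ε) + Real.exp (θ * C' * Tf) * ε)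
        + p ^ K * (L μ₂ n).toReal) atTop (𝓝 (fourStateFun K p ε Tf R μ₁ μ₂ θ C')) :=
      ((t₁.const_mul _).mul_const _).add (t₂.const_mul _)
    obtain ⟨N, hN⟩ := exists_nat_ge Tf
    -- The truncation level is past Tf, and large enough that the truncated transforms are positive
    -- and the truncated characteristic function still exceeds 1. The previous potential, with
    -- truncated transforms, then has gain at least one.
    obtain ⟨n, hn, q₁, q₂, qF⟩ := ((eventually_ge_atTop N).and
      ((t₁.eventually (lt_mem_nhds p₁)).and ((t₂.eventually (lt_mem_nhds p₂)).and
        (tF.eventually (lt_mem_nhds hF))))).exists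
    have hnT : Tf ≤ n := hN.trans (by exact_mod_cast hn)
    have hg : ∀ i, ∫⁻ y, (Set.Iic (n : ℝ)).indicator (fun y => ENNReal.ofReal (Real.exp
          (θ * C' * y - θ * ((fourState K p ε Tf R μ₁ μ₂).rate i * y)))) y
            ∂(fourState K p ε Tf R μ₁ μ₂).dwell i =
        ENNReal.ofReal (![(L μ₁ n).toReal, (L μ₂ n).toReal,
          Real.exp (θ * C' * Tf), Real.exp ((-R * θ + θ * C') * Tf)] i) := by
      intro i
      fin_cases i
      · refine Eq.trans ?_ (ENNReal.ofReal_toReal (f₁ n)).symm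
        simp [fourState, hL]
      · refine Eq.trans ?_ (ENNReal.ofReal_toReal (f₂ n)).symm
        simp [fourState, hL]
      · refine (lintegral_dirac Tf _).trans ?_
        simp [fourState, hnT]
      · refine (lintegral_dirac Tf _).trans ?_
        simp [fourState, hnT]
        ring_nf
    generalize Real.exp (θ * C' * Tf) = f at *
    generalize Real.exp ((-R * θ + θ * C') * Tf) = o at *
    generalize (L μ₁ n).toReal = m₁ at *
    generalize (L μ₂ n).toReal = m₂ at *
    have hv : ∀ i, 0 < (![m₁ * (ε * f + (1 - ε) * o), m₂, f, o] : Fin 4 → ℝ) i := by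
      intro i
      fin_cases i
      · have : 0 < m₁ * (ε * f + (1 - ε) * o) := by positivity
        simpa using this
      · exact q₂
      · exact pf
      · exact po
    have hw : 1 ≤ (1 - p ^ K) * (m₁ * (ε * f + (1 - ε) * o)) + p ^ K * m₂ := by
      refine qF.le.trans_eq ?_
      ring
    refine ⟨_, hv, n, fun i => ?_⟩
    rw [stepGain_fourState hp0 hp1.le hε0 hε1.le (fun i => (hv i).le) ?_ hg]
    · refine ENNReal.ofReal_le_ofReal ?_
      fin_cases i
      · simp
      · simpa using le_mul_of_one_le_right q₂.le hw
      · simpa using le_mul_of_one_le_right pf.le hw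
      · simpa using le_mul_of_one_le_right po.le hw
    · intro i
      fin_cases i <;> simp [q₁.le, q₂.le, pf.le, po.le]

end FourState

/-! ### The capacity of the two-state model -/

theorem twoState_isEffectiveCapacity {Tf R θ C : ℝ} {μ₃ : Measure ℝ} [IsProbabilityMeasure μ₃]
    {Ω : Type*} [MeasurableSpace Ω] {P : Measure Ω}
    [IsProbabilityMeasure P] {X : ℕ → Ω → Fin 2} {T : ℕ → Ω → ℝ}
    (hXT : IsSemiMarkov (twoState Tf R μ₃) P X T)
    (hTf : 0 < Tf) (hR : 0 ≤ R) (hμ₃ : ∀ᵐ x ∂μ₃, 0 ≤ x) (hθ : 0 < θ)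
    (hC0 : 0 ≤ C) (hC : TwoStateEquation Tf R μ₃ θ C) :
    IsEffectiveCapacity P (service (twoState Tf R μ₃) X T) θ C := by
  obtain ⟨hint, hC⟩ := hC
  have p₃ := pgf_exp_pos hint
  refine hXT.isEffectiveCapacity (B := R * Tf) hθ hC0 ?_
    (twoState_dwell_nonneg hTf.le hμ₃) ?_ ?_ ?_ ?_
  · intro i
    fin_cases i <;> simp [twoState, hR]
  · have hB : 0 ≤ R * Tf := by positivity
    intro i
    fin_cases i <;> simp [twoState, hB]
  -- The discount exp(-Tf) of a full cycle is split evenly between the two jumps.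
  · refine ⟨![1, Real.exp (-Tf / 2)], ?_, Real.exp (-Tf / 2), (Real.exp_pos _).le,
      Real.exp_lt_one_iff.2 (by linarith), ?_⟩
    · intro i
      fin_cases i <;> simp [Real.exp_pos]
    · intro i
      fin_cases i
      · have hexp : Real.exp (-1) ≤ 1 := Real.exp_le_one_iff.2 (by norm_num)
        have k := pgf_le_one hμ₃ (Real.exp_pos (-1)).le hexp
        have e := lintegral_exp_eq
          (integrable_rpow_of_le_one hμ₃ (Real.exp_pos (-1)).le hexp)
        simp only [neg_mul, one_mul] at e
        refine (stepGain_twoState_off _ _).trans_le ?_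
        rw [e]
        calc ENNReal.ofReal (pgf μ₃ (Real.exp (-1))) * ENNReal.ofReal (Real.exp (-Tf / 2))
            ≤ 1 * ENNReal.ofReal (Real.exp (-Tf / 2)) := by
              gcongr
              simpa using k
          _ = _ := by simp
      · refine (stepGain_twoState_on _ _).trans_le ?_
        have : Real.exp (-Tf) = Real.exp (-Tf / 2) * Real.exp (-Tf / 2) := by
          rw [← Real.exp_add]
          ring_nf
        simp [this]
  · refine ⟨![1, Real.exp (-θ * (R - C) * Tf)], ?_, ?_⟩
    · intro i
      fin_cases i <;> simp [Real.exp_pos]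
    · intro i
      fin_cases i
      · refine (stepGain_twoState_off _ _).trans_le ?_
        have e : ∫⁻ y, ENNReal.ofReal (Real.exp (θ * C * y - θ * ((twoState Tf R μ₃).rate 0 * y)))
            ∂μ₃ = ENNReal.ofReal (pgf μ₃ (Real.exp (θ * C))) := by
          rw [← lintegral_exp_eq hint]
          simp [twoState]
        rw [e, ← ENNReal.ofReal_mul p₃.le]
        exact ENNReal.ofReal_le_ofReal ((mul_comm _ _).trans_le hC.le)
      · refine (stepGain_twoState_on _ _).trans_le ?_
        rw [← ENNReal.ofReal_mul (Real.exp_pos _).le]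
        refine ENNReal.ofReal_le_ofReal ?_
        simp [twoState]
        linarith
  · intro C' hC'
    set f : ℝ → ENNReal := fun y => ENNReal.ofReal (Real.exp (θ * C' * y)) with hf
    have hmeas : Measurable f := by fun_prop
    set o := Real.exp (-θ * (R - C') * Tf) with ho
    have po : 0 < o := Real.exp_pos _
    -- The OFF transform may be infinite at C' > C, so it is only bounded below by its value at `C`;
    -- strictness comes from the ON factor.
    have hlt : 1 < (∫⁻ y, f y ∂μ₃) * ENNReal.ofReal o := by
      have h1 : Real.exp (-θ * (R - C) * Tf) < o := by
        rw [ho, Real.exp_lt_exp]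
        nlinarith [mul_pos hθ hTf]
      calc (1 : ENNReal) = ENNReal.ofReal (pgf μ₃ (Real.exp (θ * C)) *
            Real.exp (-θ * (R - C) * Tf)) := by rw [mul_comm, hC, ENNReal.ofReal_one]
        _ < ENNReal.ofReal (pgf μ₃ (Real.exp (θ * C)) * o) := by
          rw [ENNReal.ofReal_lt_ofReal_iff (by positivity)]
          gcongr
        _ = (∫⁻ y, ENNReal.ofReal (Real.exp (θ * C * y)) ∂μ₃) * ENNReal.ofReal o := by
          rw [lintegral_exp_eq hint, ENNReal.ofReal_mul p₃.le]
        _ ≤ _ := by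
          refine mul_le_mul_left (lintegral_mono_ae ?_) _
          filter_upwards [hμ₃] with y hy
          refine ENNReal.ofReal_le_ofReal ?_
          gcongr
    have tl := ENNReal.Tendsto.mul_const (b := ENNReal.ofReal o)
      (tendsto_lintegral_indicator_Iic (μ := μ₃) hmeas) (Or.inr ENNReal.ofReal_ne_top)
    obtain ⟨N, hN⟩ := exists_nat_ge Tf
    obtain ⟨n, hn, hn1⟩ := ((eventually_ge_atTop N).and
      (tl.eventually (lt_mem_nhds hlt))).exists
    have hnT : Tf ≤ n := hN.trans (by exact_mod_cast hn)
    refine ⟨![1, o], ?_, n, ?_⟩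
    · intro i
      fin_cases i <;> simp [po]
    · intro i
      fin_cases i
      · refine le_of_le_of_eq ?_ (stepGain_twoState_off _ _).symm
        simpa [twoState, hf] using hn1.le
      · refine le_of_le_of_eq ?_ (stepGain_twoState_on _ _).symm
        simp [twoState, hnT, ho]
        refine ENNReal.ofReal_le_ofReal (Real.exp_le_exp.2 ?_)
        linarith

/-- A divergent integral has default value 0, which is incompatible with a product equal to 1. Hence
φ = 1 already forces convergence. -/
theorem twoState_phi_eq_one_iff_equation (Tf R : ℝ) (μ₃ : Measure ℝ) (θ C : ℝ) :
    (twoState Tf R μ₃).phi (-θ) (-θ * C) = 1 ↔ TwoStateEquation Tf R μ₃ θ C := by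
  rw [twoState_phi_eq_one_iff, TwoStateEquation,
    show (R * -θ - -θ * C) * Tf = -θ * (R - C) * Tf by ring,
    show -(-θ * C) = θ * C by ring, ← pgf_exp]
  refine ⟨fun h => ⟨?_, h⟩, fun h => h.2⟩
  by_contra hint
  rw [pgf, integral_undef hint, mul_zero] at h
  exact zero_ne_one h

theorem fourState_phi_eq_one_iff_equation {K : ℕ} {p ε Tf R : ℝ} (hp0 : 0 ≤ p) (hp1 : p ≤ 1)
    (hε0 : 0 ≤ ε) (hε1 : ε ≤ 1) (μ₁ μ₂ : Measure ℝ) (θ C : ℝ) :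
    FourStateEquation K p ε Tf R μ₁ μ₂ θ C ↔
      (fourState K p ε Tf R μ₁ μ₂).phi (-θ) (-θ * C) = 1 := by
  rw [fourState_phi_eq_one_iff K hp0 hp1 hε0 hε1, FourStateEquation,
    show (R * -θ - -θ * C) * Tf = (-R * θ + θ * C) * Tf by ring,
    show -(-θ * C) = θ * C by ring, ← pgf_exp, ← pgf_exp, add_comm]

/-! ### The law of t₃ and the equivalence of the equations -/

section ReturnLaw

variable {K : ℕ} {p ε Tf R : ℝ} {μ₁ μ₂ : Measure ℝ} [IsProbabilityMeasure μ₁]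
  [IsProbabilityMeasure μ₂]

theorem integrable_returnLaw_fourState (hp0 : 0 ≤ p) (hq : p ^ K < 1) (hε0 : 0 ≤ ε)
    (hε1 : ε < 1) (hTf : 0 < Tf) (hμ₁ : ∀ᵐ x ∂μ₁, 0 ≤ x) (hμ₂ : ∀ᵐ x ∂μ₂, 0 ≤ x) {z : ℝ}
    (hz : 0 ≤ z) (h₁ : Integrable (fun x : ℝ => z ^ x) μ₁)
    (h₂ : Integrable (fun x : ℝ => z ^ x) μ₂) :
    (Integrable (fun x : ℝ => z ^ x) (returnLaw (fourState K p ε Tf R μ₁ μ₂) 3) ↔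
      p ^ K * pgf μ₂ z + ε * (1 - p ^ K) * pgf μ₁ z * z ^ Tf < 1) ∧
    (Integrable (fun x : ℝ => z ^ x) (returnLaw (fourState K p ε Tf R μ₁ μ₂) 3) →
      pgf (returnLaw (fourState K p ε Tf R μ₁ μ₂) 3) z =
        (1 - ε) * (1 - p ^ K) * pgf μ₁ z /
          (1 - p ^ K * pgf μ₂ z - ε * (1 - p ^ K) * pgf μ₁ z * z ^ Tf)) := by
  have hq0 : 0 ≤ p ^ K := pow_nonneg hp0 K
  have hε : 0 < 1 - ε := by linarith
  have hq1 : 0 < 1 - p ^ K := by linarith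
  have hz' : 0 ≤ z ^ Tf := Real.rpow_nonneg hz Tf
  have n₁ : 0 ≤ pgf μ₁ z := pgf_nonneg hz
  have n₂ : 0 ≤ pgf μ₂ z := pgf_nonneg hz
  have key := lintegral_rpow_returnLaw_fourState (K := K) (p := p) (ε := ε) (R := R) hTf.le
    hμ₁ hμ₂ hz
  rw [lintegral_rpow_eq hz h₁, lintegral_rpow_eq hz h₂, ← ENNReal.ofReal_mul hε.le,
    ← ENNReal.ofReal_mul (by positivity), ← ENNReal.ofReal_mul hq0, ← ENNReal.ofReal_mul hε0,
    ← ENNReal.ofReal_mul (by positivity), ← ENNReal.ofReal_mul (by positivity),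
    ← ENNReal.ofReal_add (by positivity) (by positivity), ← ENNReal.ofReal_one,
    ← ENNReal.ofReal_sub _ (by positivity)] at key
  have hiff : Integrable (fun x : ℝ => z ^ x) (returnLaw (fourState K p ε Tf R μ₁ μ₂) 3) ↔
      p ^ K * pgf μ₂ z + ε * (1 - p ^ K) * pgf μ₁ z * z ^ Tf < 1 := by
    rw [integrable_rpow_iff hz, key]
    constructor
    · intro h
      by_contra! hge
      refine h ?_
      rw [ENNReal.ofReal_of_nonpos (sub_nonpos.2 hge), ENNReal.inv_zero, ENNReal.mul_top]
      rw [Ne, ENNReal.ofReal_eq_zero, not_le]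
      -- The numerator must not vanish, or 0 · ⊤ = 0 would hide the divergence. At z = 0 the
      -- criterion holds automatically, contrary to `hge`.
      have : 0 < pgf μ₁ z := by
        rcases hz.eq_or_lt with h0 | h0
        · have h0' := pgf_le_one hμ₂ hz (h0 ▸ zero_le_one)
          rw [← h0, Real.zero_rpow hTf.ne', mul_zero, add_zero] at hge
          rw [← h0] at h0'
          have := mul_le_mul_of_nonneg_left h0' hq0
          linarith
        · rw [← Real.exp_log h0] at h₁ ⊢
          exact pgf_exp_pos h₁
      positivity
    · intro h
      exact ENNReal.mul_ne_top ENNReal.ofReal_ne_top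
        (ENNReal.inv_ne_top.2 (by simpa using h))
  refine ⟨hiff, fun h => ?_⟩
  have hlt := hiff.1 h
  rw [pgf_eq_toReal hz, key, ENNReal.toReal_mul, ENNReal.toReal_inv,
    ENNReal.toReal_ofReal (by positivity), ENNReal.toReal_ofReal (by linarith), sub_sub,
    div_eq_mul_inv]

/-- The total mass is the transform at z = 1, where numerator and denominator both equal (1 - ε)(1 -
p^K). -/
theorem isProbabilityMeasure_returnLaw_fourState (hp0 : 0 ≤ p) (hq : p ^ K < 1) (hε0 : 0 ≤ ε)
    (hε1 : ε < 1) (hTf : 0 < Tf) (hμ₁ : ∀ᵐ x ∂μ₁, 0 ≤ x) (hμ₂ : ∀ᵐ x ∂μ₂, 0 ≤ x) :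
    IsProbabilityMeasure (returnLaw (fourState K p ε Tf R μ₁ μ₂) 3) := by
  have i₁ : Integrable (fun x : ℝ => (1 : ℝ) ^ x) μ₁ := by simp
  have i₂ : Integrable (fun x : ℝ => (1 : ℝ) ^ x) μ₂ := by simp
  have o₁ : pgf μ₁ 1 = 1 := by simp [pgf]
  have o₂ : pgf μ₂ 1 = 1 := by simp [pgf]
  obtain ⟨h1, h2⟩ := integrable_returnLaw_fourState (K := K) (R := R) hp0 hq hε0 hε1 hTf hμ₁ hμ₂
    zero_le_one i₁ i₂
  rw [o₁, o₂, Real.one_rpow] at h1 h2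
  have hpos : 0 < (1 - ε) * (1 - p ^ K) := mul_pos (by linarith) (by linarith)
  have hint := h1.2 (by linarith)
  have h3 := h2 hint
  have h4 := lintegral_rpow_eq zero_le_one hint
  rw [h3] at h4
  constructor
  simp only [Real.one_rpow, ENNReal.ofReal_one, lintegral_one] at h4
  rw [h4, show 1 - p ^ K * 1 - ε * (1 - p ^ K) * 1 * 1 = (1 - ε) * (1 - p ^ K) by ring, mul_one,
    div_self hpos.ne', ENNReal.ofReal_one]

theorem returnLaw_fourState_ae_nonneg (hTf : 0 ≤ Tf) (hμ₁ : ∀ᵐ x ∂μ₁, 0 ≤ x)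
    (hμ₂ : ∀ᵐ x ∂μ₂, 0 ≤ x) : ∀ᵐ x ∂returnLaw (fourState K p ε Tf R μ₁ μ₂) 3, 0 ≤ x := by
  rw [returnLaw, Measure.ae_sum_iff]
  exact fun k => passageLaw_ae_nonneg (fourState_dwell_nonneg hTf hμ₁ hμ₂) 3 k 3

/-- If ON were never charged, neither would be OFF₂, which leads to ON with probability 1 - ε > 0.
Then no initial state would be, since each other state leads to OFF₂ with probability 1 - p^K > 0.
-/
theorem fourState_exists_on {Ω : Type*} [MeasurableSpace Ω] {P : Measure Ω}
    [IsProbabilityMeasure P] {X : ℕ → Ω → Fin 4} {T : ℕ → Ω → ℝ}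
    (h : IsSemiMarkov (fourState K p ε Tf R μ₁ μ₂) P X T) (hq : p ^ K < 1) (hε1 : ε < 1) :
    ∃ n, P {ω | X n ω = 3} ≠ 0 := by
  by_contra! hall
  have step : ∀ n i j, 0 < (fourState K p ε Tf R μ₁ μ₂).trans i j →
      P {ω | X (n + 1) ω = j} = 0 → P {ω | X n ω = i} = 0 := by
    intro n i j hij hj
    have e := h.measure_step n i j Set.univ (@MeasurableSet.univ _ (pastSigma X T n)) Set.univ
      MeasurableSet.univ
    simp only [Set.univ_inter, Set.preimage_univ, measure_univ, mul_one] at e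
    rw [measure_mono_null Set.inter_subset_right hj, eq_comm, mul_eq_zero] at e
    exact e.resolve_right (by simpa using hij)
  have h0 : ∀ n, P {ω | X n ω = 0} = 0 := fun n =>
    step n 0 3 (by simpa [fourState] using hε1) (hall (n + 1))
  have hi : ∀ i, P {ω | X 0 ω = i} = 0 := by
    intro i
    by_cases hi0 : i = 0
    · rw [hi0]
      exact h0 0
    · refine step 0 i 0 ?_ (h0 1)
      fin_cases i
      · exact absurd rfl hi0
      all_goals simpa [fourState] using hq
  have huniv : (⋃ i, {ω | X 0 ω = i}) = Set.univ := by
    ext ω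
    simp
  have := measure_iUnion_null hi
  rw [huniv, measure_univ] at this
  exact one_ne_zero this

theorem twoStateEquation_iff_fourStateEquation (hp0 : 0 ≤ p) (hq : p ^ K < 1) (hε0 : 0 ≤ ε)
    (hε1 : ε < 1) (hTf : 0 < Tf) (hμ₁ : ∀ᵐ x ∂μ₁, 0 ≤ x) (hμ₂ : ∀ᵐ x ∂μ₂, 0 ≤ x)
    (h₁ : ∀ t : ℝ, Integrable (fun x : ℝ => Real.exp t ^ x) μ₁)
    (h₂ : ∀ t : ℝ, Integrable (fun x : ℝ => Real.exp t ^ x) μ₂) (θ C : ℝ) :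
    TwoStateEquation Tf R (returnLaw (fourState K p ε Tf R μ₁ μ₂) 3) θ C ↔
      FourStateEquation K p ε Tf R μ₁ μ₂ θ C := by
  obtain ⟨hiff, hval⟩ := integrable_returnLaw_fourState (K := K) (R := R) hp0 hq hε0 hε1 hTf hμ₁
    hμ₂ (Real.exp_pos (θ * C)).le (h₁ (θ * C)) (h₂ (θ * C))
  rw [exp_rpow] at hiff hval
  have p₁ := pgf_exp_pos (h₁ (θ * C))
  have po := Real.exp_pos ((-R * θ + θ * C) * Tf)
  have hε : 0 < 1 - ε := by linarith
  have hq1 : 0 < 1 - p ^ K := by linarith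
  rw [TwoStateEquation, FourStateEquation,
    show -θ * (R - C) * Tf = (-R * θ + θ * C) * Tf by ring]
  constructor
  · rintro ⟨hint, heq⟩
    have hD := hiff.1 hint
    rw [hval hint, mul_div_assoc', div_eq_one_iff_eq (by linarith)] at heq
    linear_combination heq
  · intro heq
    -- The success term of the four-state equation is positive, so the remaining terms sum to less
    -- than 1: this is the convergence criterion for t₃.
    have hpos : 0 < (1 - p ^ K) * pgf μ₁ (Real.exp (θ * C)) *
        (Real.exp ((-R * θ + θ * C) * Tf) * (1 - ε)) := by positivity
    have hD : p ^ K * pgf μ₂ (Real.exp (θ * C)) +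
        ε * (1 - p ^ K) * pgf μ₁ (Real.exp (θ * C)) * Real.exp (θ * C * Tf) < 1 := by
      linarith
    refine ⟨hiff.2 hD, ?_⟩
    rw [hval (hiff.2 hD), mul_div_assoc', div_eq_one_iff_eq (by linarith)]
    linear_combination heq

end ReturnLaw

theorem corollary1 {Ω : Type*} [MeasurableSpace Ω] (P : Measure Ω) [IsProbabilityMeasure P]
    (K : ℕ) (hK : 1 ≤ K) (p ε Tf R : ℝ) (hp0 : 0 ≤ p) (hp1 : p < 1) (hε0 : 0 ≤ ε) (hε1 : ε < 1)
    (hTf : 0 < Tf) (hR : 0 ≤ R)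
    (μ₁ μ₂ : Measure ℝ) [IsProbabilityMeasure μ₁] [IsProbabilityMeasure μ₂]
    (hμ₁ : ∀ᵐ x ∂μ₁, 0 ≤ x) (hμ₂ : ∀ᵐ x ∂μ₂, 0 ≤ x)
    (hz₁ : ∀ z : ℝ, 1 < z → Integrable (fun x : ℝ => z ^ x) μ₁)
    (hz₂ : ∀ z : ℝ, 1 < z → Integrable (fun x : ℝ => z ^ x) μ₂)
    (X : ℕ → Ω → Fin 4) (T : ℕ → Ω → ℝ)
    (hXT : IsSemiMarkov (fourState K p ε Tf R μ₁ μ₂) P X T) :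
    ∃ μ₃ : Measure ℝ, IsProbabilityMeasure μ₃ ∧ (∀ᵐ x ∂μ₃, 0 ≤ x) ∧
      -- `μ₃` is the law of the time between any two consecutive successful transmissions
      (∃ n, P {ω | X n ω = 3} ≠ 0) ∧
      (∀ n, P {ω | X n ω = 3} ≠ 0 → (P[|{ω | X n ω = 3}]).map (offDuration X T n) = μ₃) ∧
      -- its probability generating function, with the exact domain of convergence
      (∀ z : ℝ, 0 ≤ z →
        (Integrable (fun x : ℝ => z ^ x) μ₃ ↔
          p ^ K * pgf μ₂ z + ε * (1 - p ^ K) * pgf μ₁ z * z ^ Tf < 1) ∧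
        (Integrable (fun x : ℝ => z ^ x) μ₃ →
          pgf μ₃ z = (1 - ε) * (1 - p ^ K) * pgf μ₁ z /
            (1 - p ^ K * pgf μ₂ z - ε * (1 - p ^ K) * pgf μ₁ z * z ^ Tf))) ∧
      ∀ θ : ℝ, 0 < θ →
        -- the characteristic equations of the two models are equivalent
        (∀ C : ℝ,
          ((twoState Tf R μ₃).phi (-θ) (-θ * C) = 1 ↔ TwoStateEquation Tf R μ₃ θ C) ∧
          (TwoStateEquation Tf R μ₃ θ C ↔ FourStateEquation K p ε Tf R μ₁ μ₂ θ C) ∧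
          (FourStateEquation K p ε Tf R μ₁ μ₂ θ C ↔
            (fourState K p ε Tf R μ₁ μ₂).phi (-θ) (-θ * C) = 1)) ∧
        -- their unique solution is the effective capacity of both models
        ∃ C : ℝ, (∀ C' : ℝ, TwoStateEquation Tf R μ₃ θ C' ↔ C' = C) ∧
          IsEffectiveCapacity P (service (fourState K p ε Tf R μ₁ μ₂) X T) θ C ∧
          ∀ (Ω' : Type*) [MeasurableSpace Ω'] (P' : Measure Ω') [IsProbabilityMeasure P']
            (Y : ℕ → Ω' → Fin 2) (U : ℕ → Ω' → ℝ),
            IsSemiMarkov (twoState Tf R μ₃) P' Y U →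
              IsEffectiveCapacity P' (service (twoState Tf R μ₃) Y U) θ C := by
  have hq : p ^ K < 1 := pow_lt_one₀ hp0 hp1 (by lia)
  have h₁ : ∀ z : ℝ, 0 ≤ z → Integrable (fun x : ℝ => z ^ x) μ₁ := fun z hz =>
    integrable_rpow_of_one_lt hμ₁ hz₁ hz
  have h₂ : ∀ z : ℝ, 0 ≤ z → Integrable (fun x : ℝ => z ^ x) μ₂ := fun z hz =>
    integrable_rpow_of_one_lt hμ₂ hz₂ hz
  have e₁ := fun t : ℝ => h₁ _ (Real.exp_pos t).le
  have e₂ := fun t : ℝ => h₂ _ (Real.exp_pos t).le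
  have hprob : IsProbabilityMeasure (returnLaw (fourState K p ε Tf R μ₁ μ₂) 3) :=
    isProbabilityMeasure_returnLaw_fourState hp0 hq hε0 hε1 hTf hμ₁ hμ₂
  have hnonneg := returnLaw_fourState_ae_nonneg (K := K) (p := p) (ε := ε) (R := R) hTf.le hμ₁ hμ₂
  have hequiv := twoStateEquation_iff_fourStateEquation (K := K) (p := p) (R := R) hp0 hq hε0 hε1
    hTf hμ₁ hμ₂ e₁ e₂
  refine ⟨returnLaw (fourState K p ε Tf R μ₁ μ₂) 3, hprob, hnonneg, fourState_exists_on hXT hq hε1,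
    fun n hn => ?_, fun z hz => integrable_returnLaw_fourState hp0 hq hε0 hε1 hTf hμ₁ hμ₂ hz
      (h₁ z hz) (h₂ z hz), fun θ hθ => ⟨fun C => ⟨twoState_phi_eq_one_iff_equation _ _ _ _ _,
        hequiv θ C, fourState_phi_eq_one_iff_equation hp0 hp1.le hε0 hε1.le _ _ _ _⟩, ?_⟩⟩
  · have hmap := hXT.map_return 3 n (measure_univ (μ := returnLaw (fourState K p ε Tf R μ₁ μ₂) 3))
      (f := offDuration X T n) fun k ω hω => offDuration_eq hω
    rw [ProbabilityTheory.cond, Measure.map_smul, hmap, smul_smul,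
      ENNReal.inv_mul_cancel hn (measure_ne_top _ _), one_smul]
  · obtain ⟨C, hC0, hC⟩ := exists_fourStateFun_eq_one (K := K) hp0 hq hε0 hε1 hTf hR hμ₁ hμ₂ e₁ e₂
      hθ
    have hmono := strictMono_fourStateFun (K := K) (R := R) hp0 hq hε0 hε1 hTf hμ₁ hμ₂ e₁ e₂ hθ
    refine ⟨C, fun C' => ?_, fourState_isEffectiveCapacity hXT hp0 hp1 hq hε0 hε1 hTf hR hμ₁ hμ₂
      e₁ e₂ hθ hC0 hC, fun Ω' _ P' _ Y U hYU =>
        twoState_isEffectiveCapacity hYU hTf hR hnonneg hθ hC0 ((hequiv θ C).2 hC)⟩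
    rw [hequiv θ C']
    refine ⟨fun h => hmono.injective (Eq.trans h hC.symm), fun h => ?_⟩
    rw [h]
    exact hC
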